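/- Let $n,l\ge 1$ be integers, $k\in\mathbb C$ and $\alpha=k+(l-1)n$. Let $U(\hat{\mathfrak{gl}}_n^{\alpha})^{\otimes l}$ be the associative $\mathbb C$-algebra generated by $E^{[s]}_{i,j}(m)$ ($1\le s\le l$, $1\le i,j\le n$, $m\in\mathbb Z$) with relations $$[E^{[s]}_{i,j}(m),E^{[t]}_{p,q}(m')]=\delta_{st}\Big(\delta_{jp}E^{[s]}_{i,q}(m+m')-\delta_{iq}E^{[s]}_{p,j}(m+m')+m\,\delta_{m+m',0}(\delta_{iq}\delta_{jp}\alpha+\delta_{ij}\delta_{pq})\Big),$$ graded by $\deg E^{[s]}_{i,j}(m)=m$. For a $\mathbb Z$-graded algebra $A=\bigoplus_d A_d$ let $A_{\mathrm{comp}}=\bigoplus_{d}\varprojlim_m A_d/\sum_{r>m}A_{d-r}A_r$ be its standard degree-wise completion, and let $U(\hat{\mathfrak{gl}}_n^{\alpha})^{\otimes l}_{\mathrm{comp}}$ be the degree-wise completion of the algebra above; it is the current algebra of $V^{\tilde\kappa}(\mathfrak{gl}_n)^{\otimes l}$, where $V^{\tilde\kappa}(\mathfrak{gl}_n)$ is the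 universal affine vertex algebra of $\mathfrak{gl}_n$ for the form $(E_{i,j},E_{p,q})=\delta_{iq}\delta_{jp}\alpha+\delta_{ij}\delta_{pq}$. For $X=E^{[s]}_{i,j}$ and $m\ge1$ write $X[-m]=X(-m)|0\rangle$ and let $A^{[s]}$ be the $n\times n$ matrix with $(i,j)$-entry the operator $E^{[s]}_{i,j}[-1]_{(-1)}$. Let $\tau$ be a formal operator with $[X[-m],\tau]=\alpha m X[-m-1]$, and define $W^{(r)}=(W^{(r)}_{i,j})_{i,j}$ by $$(\tau+A^{[1]})(\tau+A^{[2]})\cdots(\tau+A^{[l]})=\tau^l+\sum_{r=1}^{l}\tau^{l-r}W^{(r)},$$ applying each entry of $W^{(r)}$ to the vacuum, and $W^{(r)}=0$ for $r>l$. These are the generators of the rectangular $W$-algebra $\mathcal W^{\kappa}(\mathfrak{gl}_{ln},f)$ of level $k$ ($f$ nilpotent of Jordan type $(l^n)$), which is regarded as a vertex subalgebra of $V^{\tilde\kappa}(\mathfrak{gl}_n)^{\otimes l}$ through the Miura map. Let $W^{(r)}_{i,j}(m)\in U(\hat{\mathfrak{gl}}_n^{\alpha})^{\otimes l}_{\mathrm{comp}}$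 be the Fourier coefficient $(W^{(r)}_{i,j})_{(m+r-1)}$, where $v(z)=\sum_p v_{(p)}z^{-p-1}$. Then for each $i=1,\dots,n$ the series in $$D_i=W^{(2)}_{i,i}(0)-\sum_{m\ge0}\Big(\sum_{a=1}^{i-1}W^{(1)}_{i,a}(-m)W^{(1)}_{a,i}(m)+\sum_{a=i}^{n}W^{(1)}_{i,a}(-m-1)W^{(1)}_{a,i}(m+1)\Big)$$ converges, $D_i$ lies in $U(\hat{\mathfrak{gl}}_n^{\alpha})^{\otimes l}_{\mathrm{comp}}$, and in its degree-wise closed subalgebra topologically generated by all $W^{(r)}_{i,j}(m)$ with $1\le r\le l$, and $$[D_i,D_j]=0\qquad\text{for all } i,j=1,\dots,n.$$ -/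

import Mathlib

noncomputable section

namespace RectW

open Filter Topology UniformSpace

/-! ### The algebra `U(ĝ₀) / (𝟏 - 1) = U(ĝl_n^α)^{⊗ l}` -/

/-- The index of a generator `E_{i,j}^{[s]}(m) = E_{i,j}^{[s]} t^m`. Indices run over `Fin`. -/
structure Gen (n l : ℕ) where
  s : Fin l
  i : Fin n
  j : Fin n
  m : ℤ

/-- The bilinear form on one copy of `gl_n`:
`(E_{i,j}, E_{p,q}) = δ_{iq} δ_{jp} α + δ_{ij} δ_{pq}`. -/
def form {n : ℕ} (α : ℂ) (i j p q : Fin n) : ℂ :=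
  (if i = q ∧ j = p then α else 0) + (if i = j ∧ p = q then 1 else 0)

/-- The commutator of two generators:
`[E_{i,j}^{[s]}(m), E_{p,q}^{[t]}(m')] = δ_{st} (δ_{jp} E_{i,q}^{[s]}(m+m') - δ_{iq} E_{p,j}^{[s]}(m+m')
  + m δ_{m+m',0} (E_{i,j}, E_{p,q}))`. -/
def bracketRhs {n l : ℕ} (α : ℂ) (x y : Gen n l) : FreeAlgebra ℂ (Gen n l) :=
  if x.s = y.s then
    (if x.j = y.i then FreeAlgebra.ι ℂ (⟨x.s, x.i, y.j, x.m + y.m⟩ : Gen n l) else 0)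
    - (if x.i = y.j then FreeAlgebra.ι ℂ (⟨x.s, y.i, x.j, x.m + y.m⟩ : Gen n l) else 0)
    + (if x.m + y.m = 0 then algebraMap ℂ _ ((x.m : ℂ) * form α x.i x.j y.i y.j) else 0)
  else 0

/-- The defining relations of `U(ĝl_n^α)^{⊗ l}`. -/
inductive Rel (n l : ℕ) (α : ℂ) : FreeAlgebra ℂ (Gen n l) → FreeAlgebra ℂ (Gen n l) → Prop
  | comm (x y : Gen n l) :
      Rel n l α
        (FreeAlgebra.ι ℂ x * FreeAlgebra.ι ℂ y - FreeAlgebra.ι ℂ y * FreeAlgebra.ι ℂ x)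
        (bracketRhs α x y)

/-- `U(ĝl_n^α)^{⊗ l}`, the enveloping algebra of the affine Lie algebra of `gl_n^{⊕ l}` with the
central element set to `1`, presented on the basis `E_{i,j}^{[s]}(m)`. -/
def Env (n l : ℕ) (α : ℂ) : Type := RingQuot (Rel n l α)

instance (n l : ℕ) (α : ℂ) : Ring (Env n l α) := inferInstanceAs (Ring (RingQuot (Rel n l α)))

instance (n l : ℕ) (α : ℂ) : Algebra ℂ (Env n l α) :=
  inferInstanceAs (Algebra ℂ (RingQuot (Rel n l α)))

variable {n l : ℕ} {α : ℂ}

/-- The generator `E_{i,j}^{[s]}(m)` of `U(ĝl_n^α)^{⊗ l}`. -/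
def gen (α : ℂ) (x : Gen n l) : Env n l α :=
  RingQuot.mkAlgHom ℂ (Rel n l α) (FreeAlgebra.ι ℂ x)

/-- The homogeneous component `A_d` of `A = U(ĝl_n^α)^{⊗ l}`, for `deg X(m) = m`. -/
def homog (n l : ℕ) (α : ℂ) (d : ℤ) : Submodule ℂ (Env n l α) :=
  Submodule.span ℂ {x | ∃ w : List (Gen n l), (w.map Gen.m).sum = d ∧ (w.map (gen α)).prod = x}

/-- The left ideal `A · A_{> m}`. Its component of degree `d` is `∑_{r > m} A_{d-r} A_r`. -/
def tailIdeal (n l : ℕ) (α : ℂ) (m : ℕ) : Ideal (Env n l α) :=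
  Ideal.span {y | ∃ r : ℤ, (m : ℤ) < r ∧ y ∈ homog n l α r}

theorem gen_mem_homog (x : Gen n l) : gen α x ∈ homog n l α x.m :=
  Submodule.subset_span ⟨[x], by simp, by simp⟩

theorem mul_mem_homog {d e : ℤ} {x y : Env n l α} (hx : x ∈ homog n l α d)
    (hy : y ∈ homog n l α e) : x * y ∈ homog n l α (d + e) := by
  have h : homog n l α d * homog n l α e ≤ homog n l α (d + e) := by
    rw [homog, homog, Submodule.span_mul_span, Submodule.span_le]
    rintro _ ⟨_, ⟨v, hv, rfl⟩, _, ⟨w, hw, rfl⟩, rfl⟩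
    exact Submodule.subset_span ⟨v ++ w, by simp [hv, hw], by simp⟩
  exact h (Submodule.mul_mem_mul hx hy)

theorem gen_mem_tailIdeal (x : Gen n l) (m : ℕ) (h : (m : ℤ) < x.m) :
    gen α x ∈ tailIdeal n l α m :=
  Ideal.subset_span ⟨x.m, h, gen_mem_homog x⟩

theorem tailIdeal_anti {m m' : ℕ} (h : m ≤ m') : tailIdeal n l α m' ≤ tailIdeal n l α m := by
  refine Ideal.span_mono ?_
  rintro y ⟨r, hr, hy⟩
  exact ⟨r, by omega, hy⟩

/-- Every element of `U(ĝl_n^α)^{⊗ l}` is reached from scalars and generators. -/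
theorem env_induction {P : Env n l α → Prop} (hs : ∀ c : ℂ, P (algebraMap ℂ _ c))
    (hg : ∀ x, P (gen α x)) (hm : ∀ a b, P a → P b → P (a * b))
    (ha : ∀ a b, P a → P b → P (a + b)) (a : Env n l α) : P a := by
  obtain ⟨b, rfl⟩ := RingQuot.mkAlgHom_surjective ℂ (Rel n l α) a
  induction b using FreeAlgebra.induction with
  | grade0 c =>
    have h : RingQuot.mkAlgHom ℂ (Rel n l α) (algebraMap ℂ _ c) = algebraMap ℂ (Env n l α) c :=
      AlgHom.commutes (RingQuot.mkAlgHom ℂ (Rel n l α)) c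
    exact h ▸ hs c
  | grade1 x => exact hg x
  | mul a b h1 h2 => rw [map_mul]; exact hm _ _ h1 h2
  | add a b h1 h2 => rw [map_add]; exact ha _ _ h1 h2

theorem tailIdeal_mul_right (x : Env n l α) (i : ℕ) :
    ∃ j : ℕ, ∀ y ∈ tailIdeal n l α j, y * x ∈ tailIdeal n l α i := by
  induction x using env_induction generalizing i with
  | hs c =>
    refine ⟨i, fun y hy => ?_⟩
    rw [← Algebra.commutes]
    exact Ideal.mul_mem_left _ _ hy
  | hg x =>
    refine ⟨i + x.m.natAbs, fun y hy => ?_⟩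
    refine Submodule.span_induction (p := fun y _ => y * gen α x ∈ tailIdeal n l α i)
      ?_ (by simp) ?_ ?_ hy
    · rintro y ⟨r, hr, hy⟩
      exact Ideal.subset_span ⟨r + x.m, by omega, mul_mem_homog hy (gen_mem_homog x)⟩
    · intro a b _ _ h1 h2
      rw [add_mul]; exact Ideal.add_mem _ h1 h2
    · intro a b _ h
      rw [smul_eq_mul, mul_assoc]; exact Ideal.mul_mem_left _ _ h
  | hm a b h1 h2 =>
    obtain ⟨j, hj⟩ := h2 i
    obtain ⟨k, hk⟩ := h1 j
    exact ⟨k, fun y hy => by rw [← mul_assoc]; exact hj _ (hk _ hy)⟩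
  | ha a b h1 h2 =>
    obtain ⟨j, hj⟩ := h1 i
    obtain ⟨k, hk⟩ := h2 i
    refine ⟨max j k, fun y hy => ?_⟩
    rw [mul_add]
    exact Ideal.add_mem _ (hj _ (tailIdeal_anti (le_max_left _ _) hy))
      (hk _ (tailIdeal_anti (le_max_right _ _) hy))

theorem tailIdeal_basis (n l : ℕ) (α : ℂ) :
    RingSubgroupsBasis (fun m : ℕ => (tailIdeal n l α m).toAddSubgroup) where
  inter i j := ⟨max i j, le_inf (tailIdeal_anti (le_max_left _ _))
    (tailIdeal_anti (le_max_right _ _))⟩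
  mul i := by
    refine ⟨i, ?_⟩
    rintro _ ⟨x, _, y, hy, rfl⟩
    exact Ideal.mul_mem_left _ _ hy
  leftMul x i := ⟨i, fun _ hy => Ideal.mul_mem_left _ _ hy⟩
  rightMul x i := by
    obtain ⟨j, hj⟩ := tailIdeal_mul_right x i
    exact ⟨j, fun y hy => hj y hy⟩

/-! ### The completion -/

/-- The linear topology on `A = U(ĝl_n^α)^{⊗ l}` with the left ideals `A · A_{> m}` as a basis of
neighbourhoods of `0`. -/
instance (n l : ℕ) (α : ℂ) : TopologicalSpace (Env n l α) := (tailIdeal_basis n l α).topology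

instance (n l : ℕ) (α : ℂ) : IsTopologicalRing (Env n l α) :=
  (tailIdeal_basis n l α).toRingFilterBasis.isTopologicalRing

instance (n l : ℕ) (α : ℂ) : NonarchimedeanRing (Env n l α) :=
  (tailIdeal_basis n l α).nonarchimedean

instance (n l : ℕ) (α : ℂ) : UniformSpace (Env n l α) :=
  IsTopologicalAddGroup.rightUniformSpace (Env n l α)

instance (n l : ℕ) (α : ℂ) : IsUniformAddGroup (Env n l α) :=
  isUniformAddGroup_of_addCommGroup

instance (n l : ℕ) (α : ℂ) : ContinuousConstSMul ℂ (Env n l α) where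
  continuous_const_smul c := by
    simp only [Algebra.smul_def]
    exact continuous_const_mul _

instance (n l : ℕ) (α : ℂ) : UniformContinuousConstSMul ℂ (Env n l α) where
  uniformContinuous_const_smul c :=
    uniformContinuous_addMonoidHom_of_continuous
      (f := DistribSMul.toAddMonoidHom (Env n l α) c) (continuous_const_smul c)

/-- The Hausdorff completion `Â = lim A / (A · A_{> m})` of `A = U(ĝl_n^α)^{⊗ l}`, a complete
topological ring. The standard degree-wise completion
`A_comp = ⨁_d lim A_d / (∑_{r > m} A_{d-r} A_r)` is the subalgebra `envComp` below. -/
abbrev EnvHat (n l : ℕ) (α : ℂ) : Type := Completion (Env n l α)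

/-- `E_{i,j}^{[s]}(m)` as an element of the completion. -/
def E (α : ℂ) (s : Fin l) (i j : Fin n) (m : ℤ) : EnvHat n l α :=
  ((gen α ⟨s, i, j, m⟩ : Env n l α) : EnvHat n l α)

/-- The component of degree `d` of the closed algebra generated by elements `g x` of degree
`deg x`: the closure of the span of all monomials of total degree `d`. -/
def topDegreePart {ι : Type*} (g : ι → EnvHat n l α) (deg : ι → ℤ) (d : ℤ) :
    Submodule ℂ (EnvHat n l α) :=
  (Submodule.span ℂ
    {x | ∃ w : List ι, (w.map deg).sum = d ∧ (w.map g).prod = x}).topologicalClosure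

theorem mul_mem_topDegreePart {ι : Type*} {g : ι → EnvHat n l α} {deg : ι → ℤ} {d e : ℤ}
    {x y : EnvHat n l α} (hx : x ∈ topDegreePart g deg d) (hy : y ∈ topDegreePart g deg e) :
    x * y ∈ topDegreePart g deg (d + e) := by
  refine map_mem_closure₂ continuous_mul hx hy fun a ha b hb => ?_
  have h := Submodule.mul_mem_mul ha hb
  rw [Submodule.span_mul_span] at h
  refine Submodule.span_mono ?_ h
  rintro _ ⟨_, ⟨v, hv, rfl⟩, _, ⟨w, hw, rfl⟩, rfl⟩
  exact ⟨v ++ w, by simp [hv, hw], by simp⟩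

/-- The degree-wise closed subalgebra topologically generated by elements `g x` of degree
`deg x`. -/
def topGenerated {ι : Type*} (g : ι → EnvHat n l α) (deg : ι → ℤ) :
    Subalgebra ℂ (EnvHat n l α) :=
  Submodule.toSubalgebra (⨆ d : ℤ, topDegreePart g deg d)
    (Submodule.mem_iSup_of_mem 0
      (Submodule.le_topologicalClosure _ (Submodule.subset_span ⟨[], by simp, by simp⟩)))
    (fun x y hx hy => by
      have h := Submodule.mul_mem_mul hx hy
      rw [Submodule.iSup_mul] at h
      refine (iSup_le (a := ⨆ d : ℤ, topDegreePart g deg d) fun d => ?_) h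
      rw [Submodule.mul_iSup]
      refine iSup_le fun e => Submodule.mul_le.2 fun a ha b hb => ?_
      exact Submodule.mem_iSup_of_mem (d + e) (mul_mem_topDegreePart ha hb))

/-- The standard degree-wise completion of `U(ĝl_n^α)^{⊗ l}`. -/
def envComp (n l : ℕ) (α : ℂ) : Subalgebra ℂ (EnvHat n l α) :=
  topGenerated (fun x : Gen n l => ((gen α x : Env n l α) : EnvHat n l α)) Gen.m

/-! ### The Miura transformation -/

/-- The operator `E_{i,j}^{[s]}[-(k+1)]_{(-1)}` of left multiplication by `E_{i,j}^{[s]}(-(k+1))`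
on the universal affine vertex algebra. -/
structure Letter (n l : ℕ) where
  s : Fin l
  i : Fin n
  j : Fin n
  k : ℕ

/-- Noncommutative polynomials in the operators `X[-m]_{(-1)}`, `m ≥ 1`. A word
`X₁[-m₁]_{(-1)} ⋯ X_a[-m_a]_{(-1)}` stands for its value on the vacuum, the state
`X₁[-m₁]_{(-1)} ⋯ X_{a-1}[-m_{a-1}]_{(-1)} X_a[-m_a]`. -/
abbrev Words (n l : ℕ) : Type := MonoidAlgebra ℂ (FreeMonoid (Letter n l))

/-- The derivation with `X[-m] ↦ m X[-m-1]`, on a word. -/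
def derivWord : List (Letter n l) → Words n l
  | [] => 0
  | x :: w =>
      MonoidAlgebra.single (FreeMonoid.ofList ({ x with k := x.k + 1 } :: w)) ((x.k : ℂ) + 1)
      + MonoidAlgebra.single (FreeMonoid.of x) 1 * derivWord w

/-- The derivation with `X[-m] ↦ m X[-m-1]`. -/
def deriv (p : Words n l) : Words n l :=
  p.coeff.sum fun w c => c • derivWord w.toList

/-- The matrix `A^{[s]}` with entries `E_{i,j}^{[s]}[-1]_{(-1)}`. -/
def matA (s : Fin l) : Matrix (Fin n) (Fin n) (Words n l) :=
  Matrix.of fun i j => MonoidAlgebra.single (FreeMonoid.of ⟨s, i, j, 0⟩) 1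

/-- Right multiplication by `τ + A^{[s]}` on polynomials `∑_k τ^k c_k`, where `c_k` is a matrix of
noncommutative polynomials: since `[X[-m], τ] = α m X[-m-1]`, one has
`τ^k c_k (τ + A) = τ^{k+1} c_k + τ^k (α ∂c_k + c_k A)`. -/
def mulTauAdd (α : ℂ) (c : ℕ → Matrix (Fin n) (Fin n) (Words n l)) (s : Fin l) :
    ℕ → Matrix (Fin n) (Fin n) (Words n l) :=
  fun k => (if k = 0 then 0 else c (k - 1)) + (α • (c k).map deriv + c k * matA s)

/-- The coefficients `c_k` in `(τ + A^{[1]}) ⋯ (τ + A^{[l]}) = ∑_k τ^k c_k`. -/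
def miuraCoeff (n l : ℕ) (α : ℂ) : ℕ → Matrix (Fin n) (Fin n) (Words n l) :=
  (List.finRange l).foldl (mulTauAdd α) (fun k => if k = 0 then 1 else 0)

/-- `W_{i,j}^{(r)}`: the coefficients in `(τ + A^{[1]}) ⋯ (τ + A^{[l]}) = τ^l + ∑_r τ^{l-r} W^{(r)}`,
with `W^{(r)} = 0` for `r > l`. -/
def W (α : ℂ) (r : ℕ) (i j : Fin n) : Words n l :=
  if r ≤ l then miuraCoeff n l α (l - r) i j else 0

/-! ### Fourier coefficients -/

/-- The Fourier coefficient `X[-(k+1)]_{(p)} = (-1)^k binom(p, k) X(p - k)`,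
as `X[-(k+1)] = ∂^k X[-1] / k!` and `X[-1]_{(p)} = X(p)`. -/
def letterMode (α : ℂ) (x : Letter n l) (p : ℤ) : EnvHat n l α :=
  ((-1) ^ x.k * Ring.choose p x.k : ℤ) • E α x.s x.i x.j (p - x.k)

/-- The terms of the `p`-th Fourier coefficient
`(a_{(-1)} b)_{(p)} = ∑_{q ≥ 0} (a_{(-1-q)} b_{(p+q)} + b_{(p-1-q)} a_{(q)})`
of a normally ordered product. -/
def normalOrderTerm (a b : ℤ → EnvHat n l α) (p : ℤ) (q : ℕ) : EnvHat n l α :=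
  a (-1 - q) * b (p + q) + b (p - 1 - q) * a q

/-- The Fourier coefficients of the state that a word stands for; `|0⟩_{(p)} = δ_{p,-1}`. -/
def wordMode (α : ℂ) : List (Letter n l) → ℤ → EnvHat n l α
  | [], p => if p = -1 then 1 else 0
  | x :: w, p => ∑' q : ℕ, normalOrderTerm (letterMode α x) (wordMode α w) p q

/-- The Fourier coefficients `v_{(p)}`. -/
def mode (α : ℂ) (v : Words n l) (p : ℤ) : EnvHat n l α :=
  v.coeff.sum fun w c => c • wordMode α w.toList p

/-- `W_{i,j}^{(r)}(m) = (W_{i,j}^{(r)})_{(m+r-1)}`. -/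
def Wm (n l : ℕ) (α : ℂ) (r : ℕ) (i j : Fin n) (m : ℤ) : EnvHat n l α :=
  mode α (W (l := l) α r i j) (m + r - 1)

/-- The current algebra of the rectangular W-algebra, seen through the Miura map: the subalgebra
topologically generated by `W_{i,j}^{(r)}(m)` (of degree `m`) for `1 ≤ r ≤ l`, all `i`, `j`, `m`. -/
def currentAlgebra (n l : ℕ) (α : ℂ) : Subalgebra ℂ (EnvHat n l α) :=
  topGenerated (fun x : Fin l × Fin n × Fin n × ℤ => Wm n l α (x.1 + 1) x.2.1 x.2.2.1 x.2.2.2)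
    (fun x => x.2.2.2)

/-! ### Convergence of the Fourier coefficients -/

/-- In `Â`, left multiples of a null family form a null family. -/
theorem tendsto_mul_zero {ι : Type*} {F : Filter ι} {a b : ι → EnvHat n l α}
    (hb : Tendsto b F (𝓝 0)) : Tendsto (fun q => a q * b q) F (𝓝 0) := by
  have hbas := ((tailIdeal_basis n l α).hasBasis_nhds_zero).hasBasis_of_isDenseInducing
    (Completion.isDenseInducing_coe (α := Env n l α))
  rw [Completion.coe_zero] at hbas
  rw [hbas.tendsto_right_iff] at hb ⊢
  intro m hm
  filter_upwards [hb m hm] with q hq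
  refine map_mem_closure₂ (s := Set.range ((↑) : Env n l α → EnvHat n l α))
    continuous_mul (Completion.denseRange_coe (a q)) hq ?_
  rintro _ ⟨x, rfl⟩ _ ⟨y, hy, rfl⟩
  exact ⟨x * y, Ideal.mul_mem_left _ _ hy, by push_cast; rfl⟩

theorem tendsto_E (s : Fin l) (i j : Fin n) : Tendsto (E α s i j) atTop (𝓝 0) := by
  have h : Tendsto (fun m : ℤ => (gen α (⟨s, i, j, m⟩ : Gen n l) : Env n l α)) atTop (𝓝 0) := by
    refine (tailIdeal_basis n l α).hasBasis_nhds_zero.tendsto_right_iff.2 fun m _ => ?_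
    refine (eventually_gt_atTop (m : ℤ)).mono fun r hr => ?_
    exact gen_mem_tailIdeal (⟨s, i, j, r⟩ : Gen n l) m hr
  have h0 := (Completion.continuous_coe (Env n l α)).tendsto 0
  rw [Completion.coe_zero] at h0
  exact h0.comp h

theorem tendsto_letterMode (x : Letter n l) : Tendsto (letterMode α x) atTop (𝓝 0) := by
  have h : Tendsto (fun p : ℤ => E α x.s x.i x.j (p - x.k)) atTop (𝓝 0) :=
    (tendsto_E x.s x.i x.j).comp (tendsto_atTop_add_const_right _ _ tendsto_id)
  refine (tendsto_mul_zero (a := fun p : ℤ => (((-1) ^ x.k * Ring.choose p x.k : ℤ) : EnvHat n l α))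
    h).congr fun p => ?_
  simp only [letterMode, zsmul_eq_mul]

theorem summable_normalOrderTerm {a b : ℤ → EnvHat n l α} (ha : Tendsto a atTop (𝓝 0))
    (hb : Tendsto b atTop (𝓝 0)) (p : ℤ) : Summable (normalOrderTerm a b p) := by
  refine NonarchimedeanAddGroup.summable_of_tendsto_cofinite_zero ?_
  rw [Nat.cofinite_eq_atTop]
  have h1 : Tendsto (fun q : ℕ => b (p + q)) atTop (𝓝 0) :=
    hb.comp (tendsto_atTop_add_const_left _ _ tendsto_natCast_atTop_atTop)
  have h2 : Tendsto (fun q : ℕ => a q) atTop (𝓝 0) := ha.comp tendsto_natCast_atTop_atTop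
  have h := (tendsto_mul_zero (a := fun q : ℕ => a (-1 - q)) h1).add
    (tendsto_mul_zero (a := fun q : ℕ => b (p - 1 - q)) h2)
  rw [add_zero] at h
  exact h

theorem tendsto_tsum_normalOrderTerm {a b : ℤ → EnvHat n l α} (ha : Tendsto a atTop (𝓝 0))
    (hb : Tendsto b atTop (𝓝 0)) :
    Tendsto (fun p => ∑' q, normalOrderTerm a b p q) atTop (𝓝 0) := by
  have hbas := ((tailIdeal_basis n l α).hasBasis_nhds_zero).hasBasis_of_isDenseInducing
    (Completion.isDenseInducing_coe (α := Env n l α))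
  rw [Completion.coe_zero] at hbas
  have hmul : ∀ (m : ℕ) (x y : EnvHat n l α),
      y ∈ closure ((↑) '' ((tailIdeal n l α m).toAddSubgroup : Set (Env n l α))) →
      x * y ∈ closure ((↑) '' ((tailIdeal n l α m).toAddSubgroup : Set (Env n l α))) := by
    intro m x y hy
    refine map_mem_closure₂ (s := Set.range ((↑) : Env n l α → EnvHat n l α))
      continuous_mul (Completion.denseRange_coe x) hy ?_
    rintro _ ⟨x, rfl⟩ _ ⟨y, hy, rfl⟩
    exact ⟨x * y, Ideal.mul_mem_left _ _ hy, by push_cast; rfl⟩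
  have hadd : ∀ (m : ℕ) (x y : EnvHat n l α),
      x ∈ closure ((↑) '' ((tailIdeal n l α m).toAddSubgroup : Set (Env n l α))) →
      y ∈ closure ((↑) '' ((tailIdeal n l α m).toAddSubgroup : Set (Env n l α))) →
      x + y ∈ closure ((↑) '' ((tailIdeal n l α m).toAddSubgroup : Set (Env n l α))) := by
    intro m x y hx hy
    refine map_mem_closure₂ continuous_add hx hy ?_
    rintro _ ⟨x, hx, rfl⟩ _ ⟨y, hy, rfl⟩
    exact ⟨x + y, add_mem hx hy, by push_cast; rfl⟩
  rw [hbas.tendsto_right_iff]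
  intro m hm
  have hb' := hbas.tendsto_right_iff.1 hb m hm
  obtain ⟨P, hP⟩ := eventually_atTop.1 hb'
  obtain ⟨Q, hQ⟩ := eventually_atTop.1
    (hbas.tendsto_right_iff.1 (ha.comp tendsto_natCast_atTop_atTop : Tendsto (fun q : ℕ => a q) _ _)
      m hm)
  have hsmall : ∀ᶠ p : ℤ in atTop, ∀ q ∈ Finset.range Q,
      b (p - 1 - q) * a q ∈
        closure ((↑) '' ((tailIdeal n l α m).toAddSubgroup : Set (Env n l α))) := by
    rw [Filter.eventually_all_finset]
    intro q _
    have h1 : Tendsto (fun p : ℤ => b (p - 1 - q)) atTop (𝓝 0) :=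
      hb.comp ((tendsto_atTop_add_const_right _ (-1 - (q : ℤ)) tendsto_id).congr
        fun p => by simp only [id]; ring)
    have h2 := h1.mul_const (a q)
    rw [zero_mul] at h2
    exact hbas.tendsto_right_iff.1 h2 m hm
  filter_upwards [hsmall, eventually_ge_atTop P] with p hp hpP
  have hterm : ∀ q : ℕ, normalOrderTerm a b p q ∈
      closure ((↑) '' ((tailIdeal n l α m).toAddSubgroup : Set (Env n l α))) := by
    intro q
    refine hadd m _ _ (hmul m _ _ (hP _ (by omega))) ?_
    by_cases hq : q < Q
    · exact hp q (Finset.mem_range.2 hq)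
    · exact hmul m _ _ (hQ q (by omega))
  refine isClosed_closure.mem_of_tendsto (summable_normalOrderTerm ha hb p).hasSum
    (Eventually.of_forall fun t => ?_)
  induction t using Finset.induction_on with
  | empty =>
    rw [Finset.sum_empty]
    exact subset_closure ⟨0, zero_mem _, Completion.coe_zero⟩
  | insert q t hq ih =>
    rw [Finset.sum_insert hq]
    exact hadd m _ _ (hterm q) ih

theorem tendsto_wordMode (w : List (Letter n l)) : Tendsto (wordMode α w) atTop (𝓝 0) := by
  induction w with
  | nil =>
    refine tendsto_const_nhds.congr' ?_
    filter_upwards [eventually_ge_atTop (0 : ℤ)] with p hp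
    rw [wordMode, if_neg (by omega)]
  | cons x w ih =>
    exact (tendsto_tsum_normalOrderTerm (tendsto_letterMode x) ih).congr fun p => by rw [wordMode]

/-- All the series in the definition of `wordMode` converge. -/
theorem summable_wordMode (x : Letter n l) (w : List (Letter n l)) (p : ℤ) :
    Summable (normalOrderTerm (letterMode α x) (wordMode α w) p) :=
  summable_normalOrderTerm (tendsto_letterMode x) (tendsto_wordMode w) p

/-! ### The elements `D_i` -/

/-- The `m`-th term of the series subtracted from `W_{i,i}^{(2)}(0)` in `D_i`. -/
def quadTerm (n l : ℕ) (α : ℂ) (i : Fin n) (m : ℕ) : EnvHat n l α :=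
  ∑ a ∈ Finset.univ.filter (fun a => a < i), Wm n l α 1 i a (-m) * Wm n l α 1 a i m
  + ∑ a ∈ Finset.univ.filter (fun a => i ≤ a), Wm n l α 1 i a (-m - 1) * Wm n l α 1 a i (m + 1)

/-- `D_i = W_{i,i}^{(2)}(0) - ∑_{m ≥ 0} (∑_{a < i} W_{i,a}^{(1)}(-m) W_{a,i}^{(1)}(m)
  + ∑_{a ≥ i} W_{i,a}^{(1)}(-m-1) W_{a,i}^{(1)}(m+1))`. -/
def D (n l : ℕ) (α : ℂ) (i : Fin n) : EnvHat n l α :=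
  Wm n l α 2 i i 0 - ∑' m : ℕ, quadTerm n l α i m

end RectW

end

/-! Index the generators by integers: with E_{i,j+nm} = E_{i,j}(m) and E_{p+n,q+n} = E_{p,q} (`pE`),
the relations become those of matrix units up to congruence modulo n, plus central terms. The
products in W^{(2)}_{i,i}(0) involve pairs of distinct, hence commuting, copies s < t, and the
subtracted series is the part b < i of a full product of two W^{(1)}'s. Therefore (`exists_D_eq`)
D_i = L_i + ∑_s β_s E^{[s]}_{i,i}(0), where L_i = ∑_{b ∈ ℤ} ∑_{x,y} ([x < y] - [b < i])
E^{[x]}_{i,b} E^{[y]}_{b,i} and β does not depend on i.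

For i ≠ j the commutator [L_i, L_j] has cubic and central parts. The coefficients [s < t] - [x < 0]
satisfy a three-term identity of associative Yang–Baxter type (`coef_cyclic`). Written along the two
cycles r → c → j → r and r → j → c → r with r ≡ i, the cubic monomials cancel by it, except for what
arises from reordering factors in one and the same copy (`sum_cubic`). This remainder is quadratic
and supported on c ≡ r; summing it over simultaneous translates of r and c counts integers between
two thresholds and gives -∑_k k T_k, with T_k the `cartanTerm`. The central terms with coefficient α
cancel for each pair (b, c) (`sum_central_eq_zero`), and those of the form δ_{ij}δ_{pq} give +∑_k k
T_k (`central_add_central`). So L_i and L_j commute (`lineSum_commute`). The Cartan corrections are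
harmless because [E^{[A]}_{i,i}(0), L_j] is symmetric in i and j (`diag_comm_lineSum_symm`).

Rearranging the series is legitimate because the completion is nonarchimedean: a family tending to
zero is summable. Nonzero coefficients force either a factor of large degree at the right end or
distinct copies, whose factors can be moved there. -/

noncomputable section

namespace RectW

open Filter Topology UniformSpace

variable {n l : ℕ} {α : ℂ}

/-! ### Null families in the completion -/

/-- The basic neighbourhood of `0` in the completion given by the left ideal `A · A_{> m}`. -/
def nhd (n l : ℕ) (α : ℂ) (m : ℕ) : Set (EnvHat n l α) :=
  closure ((↑) '' ((tailIdeal n l α m).toAddSubgroup : Set (Env n l α)))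

theorem hasBasis_nhd : (𝓝 (0 : EnvHat n l α)).HasBasis (fun _ : ℕ => True) (nhd n l α) := by
  have hbas := ((tailIdeal_basis n l α).hasBasis_nhds_zero).hasBasis_of_isDenseInducing
    (Completion.isDenseInducing_coe (α := Env n l α))
  rw [Completion.coe_zero] at hbas
  exact hbas

/-- The neighbourhoods come from left ideals, so they absorb arbitrary factors on the left only.
Smallness of a monomial is always proved by bringing factors of large total degree to its right end.
-/
theorem mul_mem_nhd (m : ℕ) (x : EnvHat n l α) {y : EnvHat n l α} (hy : y ∈ nhd n l α m) :
    x * y ∈ nhd n l α m := by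
  refine map_mem_closure₂ (s := Set.range ((↑) : Env n l α → EnvHat n l α))
    continuous_mul (Completion.denseRange_coe x) hy ?_
  rintro _ ⟨x, rfl⟩ _ ⟨y, hy, rfl⟩
  exact ⟨x * y, Ideal.mul_mem_left _ _ hy, by push_cast; rfl⟩

theorem add_mem_nhd (m : ℕ) {x y : EnvHat n l α} (hx : x ∈ nhd n l α m)
    (hy : y ∈ nhd n l α m) : x + y ∈ nhd n l α m := by
  refine map_mem_closure₂ continuous_add hx hy ?_
  rintro _ ⟨x, hx, rfl⟩ _ ⟨y, hy, rfl⟩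
  exact ⟨x + y, add_mem hx hy, by push_cast; rfl⟩

theorem zero_mem_nhd (m : ℕ) : (0 : EnvHat n l α) ∈ nhd n l α m :=
  subset_closure ⟨0, zero_mem _, Completion.coe_zero⟩

theorem smul_mem_nhd (m : ℕ) (c : ℂ) {x : EnvHat n l α} (hx : x ∈ nhd n l α m) :
    c • x ∈ nhd n l α m := by
  rw [Algebra.smul_def]
  exact mul_mem_nhd m _ hx

theorem sum_mem_nhd {ι : Type*} (m : ℕ) (s : Finset ι) {f : ι → EnvHat n l α}
    (h : ∀ x ∈ s, f x ∈ nhd n l α m) : ∑ x ∈ s, f x ∈ nhd n l α m :=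
  Finset.sum_induction f (· ∈ nhd n l α m) (fun _ _ => add_mem_nhd m) (zero_mem_nhd m) h

/-- A family is null if it is small away from finite sets. -/
theorem tendsto_cofinite_iff {ι : Type*} {F : ι → EnvHat n l α} :
    Tendsto F cofinite (𝓝 0) ↔ ∀ m : ℕ, {x | F x ∉ nhd n l α m}.Finite := by
  rw [hasBasis_nhd.tendsto_right_iff]
  simp [Filter.eventually_cofinite]

theorem summable_of_null {ι : Type*} {F : ι → EnvHat n l α} (h : Tendsto F cofinite (𝓝 0)) :
    Summable F :=
  NonarchimedeanAddGroup.summable_of_tendsto_cofinite_zero h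

/-- Products of two null families are summable over pairs. -/
theorem hasSum_mul {ι κ : Type*} {u : ι → EnvHat n l α} {v : κ → EnvHat n l α}
    {U V : EnvHat n l α} (hu : HasSum u U) (hv : HasSum v V) :
    HasSum (fun x : ι × κ => u x.1 * v x.2) (U * V) := by
  have hnull : Tendsto (fun x : ι × κ => u x.1 * v x.2) cofinite (𝓝 0) := by
    rw [tendsto_cofinite_iff]
    intro m
    -- A small right factor makes the product small, which leaves finitely many y; for each of
    -- these, right multiplication by `v y` is continuous and leaves finitely many x.
    have h1 := tendsto_cofinite_iff.1 hv.summable.tendsto_cofinite_zero m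
    have h2 : ∀ y : κ, {x | u x * v y ∉ nhd n l α m}.Finite := by
      intro y
      refine tendsto_cofinite_iff.1 ?_ m
      have := hu.summable.tendsto_cofinite_zero.mul_const (v y)
      rwa [zero_mul] at this
    refine (h1.biUnion fun y _ => (h2 y).prod (Set.finite_singleton y)).subset ?_
    rintro ⟨x, y⟩ hxy
    simp only [Set.mem_iUnion]
    refine ⟨y, fun hy => hxy (mul_mem_nhd m _ hy), hxy, rfl⟩
  have hs := summable_of_null hnull
  have h := hs.hasSum.prod_fiberwise (fun x => hv.mul_left (u x))
  rw [← h.unique (hu.mul_right V)]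
  exact hs.hasSum

/-- The commutator of two sums. -/
theorem hasSum_commutator {ι κ : Type*} {u : ι → EnvHat n l α} {v : κ → EnvHat n l α}
    {U V : EnvHat n l α} (hu : HasSum u U) (hv : HasSum v V) :
    HasSum (fun x : ι × κ => u x.1 * v x.2 - v x.2 * u x.1) (U * V - V * U) :=
  (hasSum_mul hu hv).sub
    ((Equiv.prodComm ι κ).hasSum_iff.2 (hasSum_mul hv hu))

/-! ### Homogeneous elements -/

/-- The homogeneous component of degree `d` of the degree-wise completion. -/
abbrev homogHat (n l : ℕ) (α : ℂ) (d : ℤ) : Submodule ℂ (EnvHat n l α) :=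
  topDegreePart (fun x : Gen n l => ((gen α x : Env n l α) : EnvHat n l α)) Gen.m d

theorem coe_list_prod (w : List (Gen n l)) :
    (w.map fun x => ((gen α x : Env n l α) : EnvHat n l α)).prod =
      (((w.map (gen α)).prod : Env n l α) : EnvHat n l α) := by
  induction w with
  | nil => simp [Completion.coe_one]
  | cons x w ih => simp only [List.map_cons, List.prod_cons, ih, Completion.coe_mul]

theorem homogHat_subset_nhd {d : ℤ} {m : ℕ} (h : (m : ℤ) < d) {x : EnvHat n l α}
    (hx : x ∈ homogHat n l α d) : x ∈ nhd n l α m := by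
  refine closure_mono ?_ hx
  intro y hy
  refine Submodule.span_induction (p := fun y _ => y ∈ ((↑) : Env n l α → EnvHat n l α) ''
    ((tailIdeal n l α m).toAddSubgroup : Set (Env n l α))) ?_ ?_ ?_ ?_ hy
  · rintro _ ⟨w, hw, rfl⟩
    exact ⟨(w.map (gen α)).prod, Ideal.subset_span ⟨d, h, Submodule.subset_span ⟨w, hw, rfl⟩⟩,
      (coe_list_prod w).symm⟩
  · exact ⟨0, zero_mem _, Completion.coe_zero⟩
  · rintro _ _ _ _ ⟨a, ha, rfl⟩ ⟨b, hb, rfl⟩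
    exact ⟨a + b, add_mem ha hb, Completion.coe_add a b⟩
  · rintro c _ _ ⟨a, ha, rfl⟩
    refine ⟨c • a, ?_, Completion.coe_smul c a⟩
    rw [Algebra.smul_def]
    exact Ideal.mul_mem_left _ _ ha

theorem E_mem_homogHat (s : Fin l) (i j : Fin n) (m : ℤ) : E α s i j m ∈ homogHat n l α m :=
  Submodule.le_topologicalClosure _ (Submodule.subset_span ⟨[⟨s, i, j, m⟩], by simp, by simp [E]⟩)

/-- The presentation of `U(ĝl_n^α)^{⊗ l}` as an algebra homomorphism. -/
def toEnv (n l : ℕ) (α : ℂ) : FreeAlgebra ℂ (Gen n l) →ₐ[ℂ] Env n l α :=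
  RingQuot.mkAlgHom ℂ (Rel n l α)

/-- The map from the free algebra to the completion. -/
def toHat (n l : ℕ) (α : ℂ) : FreeAlgebra ℂ (Gen n l) →+* EnvHat n l α :=
  (Completion.coeRingHom (α := Env n l α)).comp (toEnv n l α).toRingHom

theorem toHat_ι (x : Gen n l) : toHat n l α (FreeAlgebra.ι ℂ x) = E α x.s x.i x.j x.m := rfl

theorem toHat_algebraMap (c : ℂ) :
    toHat n l α (algebraMap ℂ _ c) = c • (1 : EnvHat n l α) := by
  have h : toEnv n l α (algebraMap ℂ _ c) = c • (1 : Env n l α) := by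
    rw [AlgHom.commutes, Algebra.algebraMap_eq_smul_one]
  calc toHat n l α (algebraMap ℂ _ c) = ((toEnv n l α (algebraMap ℂ _ c) : Env n l α) :
        EnvHat n l α) := rfl
    _ = c • (1 : EnvHat n l α) := by rw [h, Completion.coe_smul, Completion.coe_one]

/-- The commutation relations in the completion. -/
theorem E_comm (s t : Fin l) (i j p q : Fin n) (m m' : ℤ) :
    E α s i j m * E α t p q m' - E α t p q m' * E α s i j m =
      if s = t then
        (if j = p then E α s i q (m + m') else 0) - (if i = q then E α s p j (m + m') else 0)
          + (if m + m' = 0 then ((m : ℂ) * form α i j p q) • (1 : EnvHat n l α) else 0)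
      else 0 := by
  have h : toEnv n l α (FreeAlgebra.ι ℂ ⟨s, i, j, m⟩ * FreeAlgebra.ι ℂ ⟨t, p, q, m'⟩
      - FreeAlgebra.ι ℂ ⟨t, p, q, m'⟩ * FreeAlgebra.ι ℂ ⟨s, i, j, m⟩) =
      toEnv n l α (bracketRhs α ⟨s, i, j, m⟩ ⟨t, p, q, m'⟩) :=
    RingQuot.mkAlgHom_rel ℂ (Rel.comm (α := α) (⟨s, i, j, m⟩ : Gen n l) ⟨t, p, q, m'⟩)
  have h2 : toHat n l α (FreeAlgebra.ι ℂ ⟨s, i, j, m⟩ * FreeAlgebra.ι ℂ ⟨t, p, q, m'⟩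
      - FreeAlgebra.ι ℂ ⟨t, p, q, m'⟩ * FreeAlgebra.ι ℂ ⟨s, i, j, m⟩) =
      toHat n l α (bracketRhs α ⟨s, i, j, m⟩ ⟨t, p, q, m'⟩) :=
    congrArg (Completion.coeRingHom (α := Env n l α)) h
  simp only [map_sub, map_mul, toHat_ι] at h2
  rw [h2, bracketRhs]
  simp only [apply_ite (toHat n l α), map_add, map_sub, map_zero, toHat_ι, toHat_algebraMap]

end RectW

end

noncomputable section

namespace RectW

open Filter Topology UniformSpace

variable {n l : ℕ} {α : ℂ}

/-! ### Periodic indexing of the generators -/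

/-- The residue class of an integer modulo `n`, as an index in `Fin n`. -/
def residue (n : ℕ) [NeZero n] (p : ℤ) : Fin n := Fin.ofNat n (p.natMod n)

theorem natCast_ne_zero' (n : ℕ) [NeZero n] : (n : ℤ) ≠ 0 := Int.natCast_ne_zero.2 (NeZero.ne n)

theorem natCast_pos' (n : ℕ) [NeZero n] : (0 : ℤ) < n := by
  have := natCast_ne_zero' n
  omega

theorem residue_val [NeZero n] (p : ℤ) : ((residue n p : ℕ) : ℤ) = p % n := by
  simp [residue, Int.natMod, Int.toNat_of_nonneg (Int.emod_nonneg _ (natCast_ne_zero' n))]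

theorem residue_eq_iff [NeZero n] (p q : ℤ) : residue n p = residue n q ↔ (n : ℤ) ∣ p - q := by
  rw [Fin.ext_iff, ← Int.natCast_inj, residue_val, residue_val, eq_comm,
    ← Int.modEq_iff_dvd, Int.ModEq]

theorem residue_fin [NeZero n] (i : Fin n) : residue n (i : ℤ) = i := by
  rw [Fin.ext_iff, ← Int.natCast_inj, residue_val]
  exact Int.emod_eq_of_lt (by positivity) (by exact_mod_cast i.2)

/-- The degree of the periodically indexed generator `E_{p,q}`. -/
def pdeg (n : ℕ) (p q : ℤ) : ℤ := q / n - p / n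

theorem pdeg_self (p : ℤ) : pdeg n p p = 0 := by simp [pdeg]

/-- `E_{p,q}^{[s]}` for `p, q ∈ ℤ`: one has `E_{i,j+nm}^{[s]} = E_{i,j}^{[s]}(m)` for
`0 ≤ i, j < n`, and `E_{p+n,q+n}^{[s]} = E_{p,q}^{[s]}`. -/
def pE [NeZero n] (α : ℂ) (s : Fin l) (p q : ℤ) : EnvHat n l α :=
  E α s (residue n p) (residue n q) (pdeg n p q)

variable [NeZero n]

theorem residue_congr {p q : ℤ} (k : ℤ) (h : q = p + n * k) : residue n q = residue n p := by
  rw [residue_eq_iff]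
  exact ⟨k, by rw [h]; ring⟩

theorem div_shift {p q : ℤ} (k : ℤ) (h : q = p + n * k) : q / n = p / n + k := by
  rw [h, Int.add_mul_ediv_left _ _ (natCast_ne_zero' n)]

theorem pE_shift (s : Fin l) {p q p' q' : ℤ} (k : ℤ) (hp : p' = p + n * k)
    (hq : q' = q + n * k) : pE (n := n) α s p' q' = pE α s p q := by
  rw [pE, pE, residue_congr k hp, residue_congr k hq, pdeg, pdeg, div_shift k hp, div_shift k hq]
  congr 1
  ring

theorem pE_shift' (s : Fin l) {p q p' q' : ℤ} (h : (n : ℤ) ∣ p' - p)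
    (hpq : p' - p = q' - q) : pE (n := n) α s p' q' = pE α s p q := by
  obtain ⟨k, hk⟩ := h
  exact pE_shift s k (by linarith) (by linarith)

theorem pE_mem_homogHat (s : Fin l) (p q : ℤ) : pE α s p q ∈ homogHat n l α (pdeg n p q) :=
  E_mem_homogHat _ _ _ _

/-- When the residues match, n times the total degree is the total displacement of the indices. This
turns the condition m + m' = 0 of the central term into a linear one without floor functions. -/
theorem pdeg_eq_zero_iff {p q p' q' : ℤ} (h : p % n + p' % n = q % n + q' % n) :
    pdeg n p q + pdeg n p' q' = 0 ↔ q - p + (q' - p') = 0 := by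
  have hn := natCast_ne_zero' n
  have h1 := Int.mul_ediv_add_emod p n
  have h2 := Int.mul_ediv_add_emod q n
  have h3 := Int.mul_ediv_add_emod p' n
  have h4 := Int.mul_ediv_add_emod q' n
  have key : (n : ℤ) * (pdeg n p q + pdeg n p' q') = q - p + (q' - p') := by
    simp only [pdeg, mul_add, mul_sub]
    linarith
  rw [← key, mul_eq_zero, or_iff_right hn]

/-- The commutation relations in the periodic indexing. -/
theorem pE_comm (s t : Fin l) (p q p' q' : ℤ) :
    pE (n := n) α s p q * pE α t p' q' - pE α t p' q' * pE α s p q =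
      if s = t then
        (if (n : ℤ) ∣ q - p' then pE α s p (q' + q - p') else 0)
          - (if (n : ℤ) ∣ p - q' then pE α s p' (q + q' - p) else 0)
          + ((if ((n : ℤ) ∣ p - q' ∧ (n : ℤ) ∣ q - p') ∧ q - p + (q' - p') = 0 then
              (α * (pdeg n p q : ℂ)) • (1 : EnvHat n l α) else 0)
            + (if ((n : ℤ) ∣ p - q ∧ (n : ℤ) ∣ p' - q') ∧ q - p + (q' - p') = 0 then
              (pdeg n p q : ℂ) • (1 : EnvHat n l α) else 0))
      else 0 := by
  rw [pE, pE, E_comm]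
  refine if_congr Iff.rfl ?_ rfl
  congr 1
  · congr 1
    · refine if_ctx_congr (residue_eq_iff _ _) (fun h => ?_) fun _ => rfl
      obtain ⟨k, hk⟩ := h
      -- Translating E_{p',q'} by q - p' makes its row index equal to q, which moves its column
      -- index to q' + q - p'.
      have h1 : q' + q - p' = q' + n * k := by linarith
      have h2 : q = p' + n * k := by linarith
      rw [pE, residue_congr k h1, pdeg, pdeg, pdeg, div_shift k h1, div_shift k h2]
      congr 1
      ring
    · refine if_ctx_congr (residue_eq_iff _ _) (fun h => ?_) fun _ => rfl
      obtain ⟨k, hk⟩ := h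
      have h1 : q + q' - p = q + n * (-k) := by linarith
      have h2 : p = q' + n * k := by linarith
      rw [pE, residue_congr _ h1, pdeg, pdeg, pdeg, div_shift _ h1, div_shift k h2]
      congr 1
      ring
  · simp only [form, residue_eq_iff]
    have e : ∀ x y : ℤ, (n : ℤ) ∣ x - y → x % n = y % n := fun x y h =>
      (Int.modEq_iff_dvd.2 h).symm
    have hA : (n : ℤ) ∣ p - q' ∧ (n : ℤ) ∣ q - p' →
        (pdeg n p q + pdeg n p' q' = 0 ↔ q - p + (q' - p') = 0) := fun h =>
      pdeg_eq_zero_iff (by have := e _ _ h.1; have := e _ _ h.2; linarith)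
    have hB : (n : ℤ) ∣ p - q ∧ (n : ℤ) ∣ p' - q' →
        (pdeg n p q + pdeg n p' q' = 0 ↔ q - p + (q' - p') = 0) := fun h =>
      pdeg_eq_zero_iff (by have := e _ _ h.1; have := e _ _ h.2; linarith)
    by_cases ca : (n : ℤ) ∣ p - q' ∧ (n : ℤ) ∣ q - p' <;>
    by_cases cb : (n : ℤ) ∣ p - q ∧ (n : ℤ) ∣ p' - q' <;>
    by_cases cd : pdeg n p q + pdeg n p' q' = 0 <;>
    simp [ca, cb, cd, ← hA, ← hB]
    · rw [← add_smul]
      congr 1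
      ring
    · rw [mul_comm]

theorem pE_commute {s t : Fin l} (h : s ≠ t) (p q p' q' : ℤ) :
    pE (n := n) α s p q * pE α t p' q' = pE α t p' q' * pE α s p q := by
  rw [← sub_eq_zero, pE_comm, if_neg h]

/-! ### Smallness of monomials -/

/-- Rounding costs less than n: n times the degree exceeds q - p - n, so a displacement of n(m + 2)
is ample. -/
theorem lt_pdeg {p q : ℤ} {m : ℕ} (h : (n : ℤ) * (m + 2) ≤ q - p) : (m : ℤ) < pdeg n p q := by
  have hn := natCast_pos' n
  have h1 := Int.mul_ediv_add_emod p n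
  have h2 := Int.mul_ediv_add_emod q n
  have h3 := Int.emod_nonneg p (natCast_ne_zero' n)
  have h4 := Int.emod_lt_of_pos q hn
  have h5 : (n : ℤ) * (m + 1) < n * pdeg n p q := by
    rw [pdeg, mul_sub, mul_add] at *
    linarith
  have := lt_of_mul_lt_mul_left h5 hn.le
  linarith

theorem pE_mem_nhd (s : Fin l) {p q : ℤ} {m : ℕ} (h : (n : ℤ) * (m + 2) ≤ q - p) :
    pE (n := n) α s p q ∈ nhd n l α m :=
  homogHat_subset_nhd (lt_pdeg h) (pE_mem_homogHat s p q)

theorem pE_mul_mem_nhd (s t : Fin l) {p q p' q' a b : ℤ} {m : ℕ}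
    (hab : (n : ℤ) * (m + 2) ≤ b - a)
    (h : pdeg n p q + pdeg n p' q' = pdeg n a b) :
    pE (n := n) α s p q * pE α t p' q' ∈ nhd n l α m := by
  refine homogHat_subset_nhd (lt_pdeg hab) ?_
  rw [← h]
  exact mul_mem_topDegreePart (pE_mem_homogHat _ _ _) (pE_mem_homogHat _ _ _)

/-- A cyclic monomial is small if some factors that can be moved to the right have large total
degree. -/
theorem cyclic_mem_nhd (A B C : Fin l) (p q r : ℤ) (m : ℕ)
    (h : (n : ℤ) * (m + 2) ≤ p - r ∨ (n : ℤ) * (m + 2) ≤ p - q ∨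
      (B ≠ C ∧ (n : ℤ) * (m + 2) ≤ r - q) ∨ (A ≠ B ∧ (n : ℤ) * (m + 2) ≤ q - r) ∨
      ((A ≠ B ∧ A ≠ C) ∧ (n : ℤ) * (m + 2) ≤ q - p) ∨
      ((C ≠ A ∧ C ≠ B) ∧ (n : ℤ) * (m + 2) ≤ r - p)) :
    pE (n := n) α A p q * pE α B q r * pE α C r p ∈ nhd n l α m := by
  rcases h with h | h | ⟨h1, h⟩ | ⟨h1, h⟩ | ⟨⟨h1, h2⟩, h⟩ | ⟨⟨h1, h2⟩, h⟩
  · exact mul_mem_nhd m _ (pE_mem_nhd _ h)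
  · rw [mul_assoc]
    exact mul_mem_nhd m _ (pE_mul_mem_nhd _ _ h (by simp only [pdeg]; ring))
  · rw [mul_assoc, pE_commute h1]
    exact mul_mem_nhd m _ (mul_mem_nhd m _ (pE_mem_nhd _ h))
  · rw [pE_commute h1, mul_assoc]
    exact mul_mem_nhd m _ (pE_mul_mem_nhd _ _ h (by simp only [pdeg]; ring))
  · rw [pE_commute h1, mul_assoc, pE_commute h2, ← mul_assoc]
    exact mul_mem_nhd m _ (pE_mem_nhd _ h)
  · rw [mul_assoc, pE_commute h2.symm, ← mul_assoc, pE_commute h1.symm, mul_assoc]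
    exact mul_mem_nhd m _ (pE_mul_mem_nhd _ _ h (by simp only [pdeg]; ring))

/-- The counterpart of `cyclic_mem_nhd` with the last two factors exchanged: each alternative names
one or two factors that are already last or can be commuted there. -/
theorem cyclic_mem_nhd' (A B C : Fin l) (p q r : ℤ) (m : ℕ)
    (h : (n : ℤ) * (m + 2) ≤ r - q ∨ (n : ℤ) * (m + 2) ≤ p - q ∨
      (B ≠ C ∧ (n : ℤ) * (m + 2) ≤ p - r) ∨ (A ≠ C ∧ (n : ℤ) * (m + 2) ≤ r - p) ∨
      ((A ≠ B ∧ A ≠ C) ∧ (n : ℤ) * (m + 2) ≤ q - p) ∨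
      ((B ≠ A ∧ B ≠ C) ∧ (n : ℤ) * (m + 2) ≤ q - r)) :
    pE (n := n) α A p q * pE α C r p * pE α B q r ∈ nhd n l α m := by
  rcases h with h | h | ⟨h1, h⟩ | ⟨h1, h⟩ | ⟨⟨h1, h2⟩, h⟩ | ⟨⟨h1, h2⟩, h⟩
  · exact mul_mem_nhd m _ (pE_mem_nhd _ h)
  · rw [mul_assoc]
    exact mul_mem_nhd m _ (pE_mul_mem_nhd _ _ h (by simp only [pdeg]; ring))
  · rw [mul_assoc, pE_commute h1.symm]
    exact mul_mem_nhd m _ (mul_mem_nhd m _ (pE_mem_nhd _ h))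
  · rw [pE_commute h1, mul_assoc]
    exact mul_mem_nhd m _ (pE_mul_mem_nhd _ _ h (by simp only [pdeg]; ring))
  · rw [pE_commute h2, mul_assoc, pE_commute h1, ← mul_assoc]
    exact mul_mem_nhd m _ (pE_mem_nhd _ h)
  · rw [mul_assoc, pE_commute h2.symm, ← mul_assoc, pE_commute h1.symm, mul_assoc]
    exact mul_mem_nhd m _ (pE_mul_mem_nhd _ _ h (by simp only [pdeg]; ring))

/-! ### The coefficients -/

/-- The coefficient `[s < t] - [x < 0]`. -/
def coef (s t : Fin l) (x : ℤ) : ℂ := (if s < t then 1 else 0) - (if x < 0 then 1 else 0)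

/-- This dichotomy drives all convergence: for x ≥ 0 the two copies are distinct and their factors
commute, so a factor of large degree may be moved to the right. -/
theorem coef_ne_zero {s t : Fin l} {x : ℤ} (h : coef s t x ≠ 0) :
    (s < t ∧ 0 ≤ x) ∨ (t ≤ s ∧ x < 0) := by
  by_contra! hc
  apply h
  rw [coef]
  by_cases h1 : s < t
  · simp [h1, hc.1 h1]
  · have := hc.2 (not_lt.1 h1)
    simp [h1, this]

/-- Since u ≠ 0, [-u < 0] = 1 - [u < 0]. On expanding, the terms mixing the order of the copies with
signs of integers cancel; what remains is one identity for the order on `Fin l` and one for the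
signs of u, v, u + v, each checked by cases. -/
theorem coef_cyclic (A B C : Fin l) {u : ℤ} (v : ℤ) (hu : u ≠ 0) :
    coef A C u * coef A B v + coef A B (u + v) * coef C B (-u)
      - coef A C (u + v) * coef C B v = 0 := by
  unfold coef
  rcases lt_or_gt_of_ne hu with h | h <;> rcases lt_or_ge v 0 with hv | hv <;>
  rcases lt_or_ge (u + v) 0 with hw | hw <;> (try omega) <;>
  by_cases hAB : A < B <;> by_cases hAC : A < C <;> by_cases hCB : C < B <;> (try omega) <;>
  simp [hAB, hAC, hCB, not_lt.2, h, hv, hw, h.le]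

/-- This is the negative of `coef_cyclic` for the reversed order on the copies, with A and C
exchanged; it serves the cycle of opposite orientation. -/
theorem coef_cyclic' (A B C : Fin l) {u : ℤ} (v : ℤ) (hu : u ≠ 0) :
    -(coef A C u * coef B C v) - coef B C (u + v) * coef B A (-u)
      + coef A C (u + v) * coef B A v = 0 := by
  unfold coef
  rcases lt_or_gt_of_ne hu with h | h <;> rcases lt_or_ge v 0 with hv | hv <;>
  rcases lt_or_ge (u + v) 0 with hw | hw <;> (try omega) <;>
  by_cases hAB : B < A <;> by_cases hAC : A < C <;> by_cases hCB : B < C <;> (try omega) <;>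
  simp [hAB, hAC, hCB, not_lt.2, h, hv, hw, h.le]

theorem coef_add_coef_neg (A B : Fin l) {w : ℤ} (hw : w ≠ 0) :
    coef A B w + coef B A (-w) = -(if A = B then 1 else 0) := by
  unfold coef
  split_ifs <;> first | omega | norm_num

/-- The summands differ by a constant times [y = A] - [y = B], which sums to zero. This identity
cancels the central terms with coefficient α. -/
theorem sum_coef_mul_coef (A B : Fin l) {w : ℤ} (hw : w ≠ 0) :
    ∑ y, coef A y w * coef B y (-w) = ∑ y, coef y B w * coef y A (-w) := by
  have h : ∀ y, coef A y w * coef B y (-w) - coef y B w * coef y A (-w) =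
      (if 0 < w then (if A < B then 1 else 0) else -(if B < A then 1 else 0)) *
        ((if y = A then 1 else 0) - (if y = B then 1 else 0)) := by
    intro y
    unfold coef
    split_ifs <;> first | omega | norm_num
  rw [← sub_eq_zero, ← Finset.sum_sub_distrib, Finset.sum_congr rfl fun y _ => h y,
    ← Finset.mul_sum, Finset.sum_sub_distrib]
  simp

end RectW
end

noncomputable section

namespace RectW

open Filter Topology UniformSpace

theorem box_of_not_mem {n l : ℕ} {α c₁ c₂ : ℂ} {X : EnvHat n l α} {m : ℕ}
    (h : (c₁ * c₂) • X ∉ nhd n l α m) : c₁ ≠ 0 ∧ c₂ ≠ 0 ∧ X ∉ nhd n l α m := by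
  refine ⟨?_, ?_, fun hX => h (smul_mem_nhd m _ hX)⟩ <;> rintro rfl <;> apply h <;>
    simp [zero_mem_nhd]

variable {n l : ℕ} {α : ℂ} [NeZero n]

/-! ### The quadratic series -/

/-- The `b`-th term of the quadratic series attached to `i`. -/
def lineTerm (n l : ℕ) (α : ℂ) [NeZero n] (i b : ℤ) : EnvHat n l α :=
  ∑ x : Fin l, ∑ y : Fin l, coef x y (b - i) • (pE (n := n) α x i b * pE α y b i)

/-- For b far below i the right factor E_{b,i} has large degree. For b far above i only x < y
contributes, and the commuting factor E_{i,b} can be moved to the right. -/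
theorem tendsto_lineTerm (i : ℤ) : Tendsto (lineTerm n l α i) cofinite (𝓝 0) := by
  rw [tendsto_cofinite_iff]
  intro m
  refine (Set.finite_Icc (i - n * (m + 2)) (i + n * (m + 2))).subset fun b hb => ?_
  by_contra hc
  rw [Set.mem_Icc] at hc
  refine hb (sum_mem_nhd m _ fun x _ => sum_mem_nhd m _ fun y _ => ?_)
  by_cases h0 : coef x y (b - i) = 0
  · rw [h0, zero_smul]
    exact zero_mem_nhd m
  refine smul_mem_nhd m _ ?_
  rcases coef_ne_zero h0 with ⟨h1, h2⟩ | ⟨h1, h2⟩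
  · rw [pE_commute h1.ne]
    exact mul_mem_nhd m _ (pE_mem_nhd _ (by omega))
  · exact mul_mem_nhd m _ (pE_mem_nhd _ (by omega))

/-- A family over pairs `(k, c)` is null if small outside of boxes around `j` in `(i + n k, c)`. -/
theorem tendsto_of_box {F : ℤ × ℤ → EnvHat n l α} (i j : ℤ)
    (h : ∀ m : ℕ, ∃ N : ℤ, ∀ k c, F (k, c) ∉ nhd n l α m →
      (j - N ≤ i + n * k ∧ i + n * k ≤ j + N) ∧ j - N ≤ c ∧ c ≤ j + N) :
    Tendsto F cofinite (𝓝 0) := by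
  rw [tendsto_cofinite_iff]
  intro m
  obtain ⟨N, hN⟩ := h m
  have hinj : Function.Injective fun x : ℤ × ℤ => (i + n * x.1, x.2) := by
    rintro ⟨a, b⟩ ⟨a', b'⟩ h
    simp only [Prod.mk.injEq, add_right_inj, mul_eq_mul_left_iff] at h
    rcases h with ⟨h | h, h'⟩
    · exact Prod.ext h h'
    · exact absurd h (natCast_ne_zero' n)
  refine (((Set.finite_Icc (j - N) (j + N)).prod (Set.finite_Icc (j - N) (j + N))).preimage
    hinj.injOn).subset ?_
  rintro ⟨k, c⟩ hkc
  exact hN k c hkc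

/-! ### Cubic monomials and their decay -/

section Families

variable (α) (j : ℤ) (x y z : Fin l) (r c : ℤ)

/-- The six families of cubic monomials in the commutator of two quadratic series. -/
def cubic₁ : EnvHat n l α :=
  (coef x y (c - r) * coef y z (c - j)) • (pE (n := n) α x r c * pE α y j r * pE α z c j)

/-- A family of cubic monomials, as `cubic₁`. -/
def cubic₂ : EnvHat n l α :=
  (coef x y (c - r) * coef z y (r - j)) • (pE (n := n) α x r c * pE α z j r * pE α y c j)

/-- A family of cubic monomials, as `cubic₁`. -/
def cubic₃ : EnvHat n l α :=
  (coef x y (j - r) * coef z y (c - j)) • (pE (n := n) α x r j * pE α z j c * pE α y c r)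

/-- A family of cubic monomials, as `cubic₁`. -/
def cubic₄ : EnvHat n l α :=
  (coef x y (j - r) * coef x z (c - j)) • (pE (n := n) α x r c * pE α z c j * pE α y j r)

/-- A family of cubic monomials, as `cubic₁`. -/
def cubic₅ : EnvHat n l α :=
  (coef x y (c - r) * coef x z (r - j)) • (pE (n := n) α x j c * pE α z r j * pE α y c r)

/-- A family of cubic monomials, as `cubic₁`. -/
def cubic₆ : EnvHat n l α :=
  (coef x y (c - r) * coef z x (c - j)) • (pE (n := n) α z j c * pE α x r j * pE α y c r)

end Families

/-- For all six families: nonvanishing of both coefficients fixes order relations among the copies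
and among r, c, j. The alternatives of the cyclic lemmas then bound the distances of r and c from j,
whence two steps of length n(m + 2). -/
theorem tendsto_cubic₁ (i j : ℤ) (x y z : Fin l) :
    Tendsto (fun q : ℤ × ℤ => cubic₁ (n := n) α j x y z (i + n * q.1) q.2) cofinite (𝓝 0) := by
  refine tendsto_of_box i j fun m => ⟨2 * (n * (m + 2)), fun k c h => ?_⟩
  obtain ⟨h1, h2, h3⟩ := box_of_not_mem h
  have h4 := mt (cyclic_mem_nhd' x z y (i + n * k) c j m) h3
  rcases coef_ne_zero h1 with h1 | h1 <;> rcases coef_ne_zero h2 with h2 | h2 <;>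
  · simp only [ne_eq, Fin.ext_iff, Fin.lt_def, Fin.le_def] at *
    omega

theorem tendsto_cubic₂ (i j : ℤ) (x y z : Fin l) :
    Tendsto (fun q : ℤ × ℤ => cubic₂ (n := n) α j x y z (i + n * q.1) q.2) cofinite (𝓝 0) := by
  refine tendsto_of_box i j fun m => ⟨2 * (n * (m + 2)), fun k c h => ?_⟩
  obtain ⟨h1, h2, h3⟩ := box_of_not_mem h
  have h4 := mt (cyclic_mem_nhd' x y z (i + n * k) c j m) h3
  rcases coef_ne_zero h1 with h1 | h1 <;> rcases coef_ne_zero h2 with h2 | h2 <;>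
  · simp only [ne_eq, Fin.ext_iff, Fin.lt_def, Fin.le_def] at *
    omega

theorem tendsto_cubic₃ (i j : ℤ) (x y z : Fin l) :
    Tendsto (fun q : ℤ × ℤ => cubic₃ (n := n) α j x y z (i + n * q.1) q.2) cofinite (𝓝 0) := by
  refine tendsto_of_box i j fun m => ⟨2 * (n * (m + 2)), fun k c h => ?_⟩
  obtain ⟨h1, h2, h3⟩ := box_of_not_mem h
  have h4 := mt (cyclic_mem_nhd x z y (i + n * k) j c m) h3
  rcases coef_ne_zero h1 with h1 | h1 <;> rcases coef_ne_zero h2 with h2 | h2 <;>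
  · simp only [ne_eq, Fin.ext_iff, Fin.lt_def, Fin.le_def] at *
    omega

theorem tendsto_cubic₄ (i j : ℤ) (x y z : Fin l) :
    Tendsto (fun q : ℤ × ℤ => cubic₄ (n := n) α j x y z (i + n * q.1) q.2) cofinite (𝓝 0) := by
  refine tendsto_of_box i j fun m => ⟨2 * (n * (m + 2)), fun k c h => ?_⟩
  obtain ⟨h1, h2, h3⟩ := box_of_not_mem h
  have h4 := mt (cyclic_mem_nhd x z y (i + n * k) c j m) h3
  rcases coef_ne_zero h1 with h1 | h1 <;> rcases coef_ne_zero h2 with h2 | h2 <;>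
  · simp only [ne_eq, Fin.ext_iff, Fin.lt_def, Fin.le_def] at *
    omega

theorem tendsto_cubic₅ (i j : ℤ) (x y z : Fin l) :
    Tendsto (fun q : ℤ × ℤ => cubic₅ (n := n) α j x y z (i + n * q.1) q.2) cofinite (𝓝 0) := by
  refine tendsto_of_box i j fun m => ⟨2 * (n * (m + 2)), fun k c h => ?_⟩
  obtain ⟨h1, h2, h3⟩ := box_of_not_mem h
  have h4 := mt (cyclic_mem_nhd' x y z j c (i + n * k) m) h3
  rcases coef_ne_zero h1 with h1 | h1 <;> rcases coef_ne_zero h2 with h2 | h2 <;>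
  · simp only [ne_eq, Fin.ext_iff, Fin.lt_def, Fin.le_def] at *
    omega

theorem tendsto_cubic₆ (i j : ℤ) (x y z : Fin l) :
    Tendsto (fun q : ℤ × ℤ => cubic₆ (n := n) α j x y z (i + n * q.1) q.2) cofinite (𝓝 0) := by
  refine tendsto_of_box i j fun m => ⟨2 * (n * (m + 2)), fun k c h => ?_⟩
  obtain ⟨h1, h2, h3⟩ := box_of_not_mem h
  have h4 := mt (cyclic_mem_nhd' z y x j c (i + n * k) m) h3
  rcases coef_ne_zero h1 with h1 | h1 <;> rcases coef_ne_zero h2 with h2 | h2 <;>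
  · simp only [ne_eq, Fin.ext_iff, Fin.lt_def, Fin.le_def] at *
    omega

end RectW
end

noncomputable section

namespace RectW

open Filter Topology UniformSpace

/-- The Leibniz rule in both arguments; the four summands are treated as the middle, right, left and
outer commutators. -/
theorem mul_commutator {R : Type*} [Ring R] (x y x' y' : R) :
    x * y * (x' * y') - x' * y' * (x * y) =
      x * (y * x' - x' * y) * y' + x * x' * (y * y' - y' * y)
        + (x * x' - x' * x) * y' * y + x' * (x * y' - y' * x) * y := by
  noncomm_ring

variable {n l : ℕ} {α : ℂ} [NeZero n]

/-! ### The commutators of the factors of two quadratic terms -/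

section Brackets

variable {i j : ℤ} (s t : Fin l) (b c : ℤ)

/-- In the middle and outer commutators i and j meet, so i ≢ j removes one linear term and the
central term with α. The right and left commutators keep both linear terms and all central terms. -/
theorem comm_middle (hij : ¬(n : ℤ) ∣ i - j) :
    pE (n := n) α s b i * pE α t j c - pE α t j c * pE α s b i =
      if s = t then
        (if ((n : ℤ) ∣ b - i ∧ (n : ℤ) ∣ c - j) ∧ c - j = b - i then
          (pdeg n b i : ℂ) • (1 : EnvHat n l α) else 0)
        - (if (n : ℤ) ∣ b - c then pE α s j (i + c - b) else 0)
      else 0 := by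
  rw [pE_comm, if_neg hij, if_neg (c := ((n : ℤ) ∣ b - c ∧ (n : ℤ) ∣ i - j) ∧ _) (by tauto),
    zero_add, zero_sub, neg_add_eq_sub]
  have e : (((n : ℤ) ∣ b - i ∧ (n : ℤ) ∣ j - c) ∧ i - b + (c - j) = 0) ↔
      (((n : ℤ) ∣ b - i ∧ (n : ℤ) ∣ c - j) ∧ c - j = b - i) := by
    rw [dvd_sub_comm (a := (n : ℤ)) (b := j)]
    exact and_congr Iff.rfl (by omega)
  simp only [e]

theorem comm_outer (hij : ¬(n : ℤ) ∣ i - j) :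
    pE (n := n) α s i b * pE α t c j - pE α t c j * pE α s i b =
      if s = t then
        (if ((n : ℤ) ∣ b - i ∧ (n : ℤ) ∣ c - j) ∧ c - j = b - i then
          (pdeg n i b : ℂ) • (1 : EnvHat n l α) else 0)
        + (if (n : ℤ) ∣ b - c then pE α s i (j + b - c) else 0)
      else 0 := by
  rw [pE_comm, if_neg hij, if_neg (c := ((n : ℤ) ∣ i - j ∧ (n : ℤ) ∣ b - c) ∧ _) (by tauto),
    zero_add, sub_zero, add_comm]
  have e : (((n : ℤ) ∣ i - b ∧ (n : ℤ) ∣ c - j) ∧ b - i + (j - c) = 0) ↔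
      (((n : ℤ) ∣ b - i ∧ (n : ℤ) ∣ c - j) ∧ c - j = b - i) := by
    rw [dvd_sub_comm (a := (n : ℤ)) (b := i)]
    exact and_congr Iff.rfl (by omega)
  simp only [e]

theorem comm_right :
    pE (n := n) α s b i * pE α t c j - pE α t c j * pE α s b i =
      if s = t then
        (if (n : ℤ) ∣ c - i then pE α s b (j + i - c) else 0)
        - (if (n : ℤ) ∣ b - j then pE α s c (i + j - b) else 0)
        + ((if (n : ℤ) ∣ b - j ∧ c = i + j - b then
            (α * (pdeg n b i : ℂ)) • (1 : EnvHat n l α) else 0)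
          + (if ((n : ℤ) ∣ b - i ∧ (n : ℤ) ∣ c - j) ∧ c - j = -(b - i) then
            (pdeg n b i : ℂ) • (1 : EnvHat n l α) else 0))
      else 0 := by
  rw [pE_comm]
  have e : (((n : ℤ) ∣ b - i ∧ (n : ℤ) ∣ c - j) ∧ i - b + (j - c) = 0) ↔
      (((n : ℤ) ∣ b - i ∧ (n : ℤ) ∣ c - j) ∧ c - j = -(b - i)) :=
    and_congr Iff.rfl (by omega)
  have e' : (((n : ℤ) ∣ b - j ∧ (n : ℤ) ∣ c - i) ∧ i - b + (j - c) = 0) ↔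
      ((n : ℤ) ∣ b - j ∧ c = i + j - b) := by
    constructor
    · rintro ⟨⟨h1, h2⟩, h3⟩
      exact ⟨h1, by omega⟩
    · rintro ⟨h1, h3⟩
      have h : c - i = -(b - j) := by omega
      exact ⟨⟨h1, h ▸ (dvd_neg.2 h1)⟩, by omega⟩
  have ec : (n : ℤ) ∣ i - c ↔ (n : ℤ) ∣ c - i := dvd_sub_comm
  simp only [ec, e, e']

theorem comm_left :
    pE (n := n) α s i b * pE α t j c - pE α t j c * pE α s i b =
      if s = t then
        (if (n : ℤ) ∣ b - j then pE α s i (c + b - j) else 0)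
        - (if (n : ℤ) ∣ c - i then pE α s j (b + c - i) else 0)
        + ((if (n : ℤ) ∣ b - j ∧ c = i + j - b then
            (α * (pdeg n i b : ℂ)) • (1 : EnvHat n l α) else 0)
          + (if ((n : ℤ) ∣ b - i ∧ (n : ℤ) ∣ c - j) ∧ c - j = -(b - i) then
            (pdeg n i b : ℂ) • (1 : EnvHat n l α) else 0))
      else 0 := by
  rw [pE_comm]
  have e : (((n : ℤ) ∣ i - b ∧ (n : ℤ) ∣ j - c) ∧ b - i + (c - j) = 0) ↔
      (((n : ℤ) ∣ b - i ∧ (n : ℤ) ∣ c - j) ∧ c - j = -(b - i)) := by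
    rw [dvd_sub_comm (a := (n : ℤ)) (b := i), dvd_sub_comm (a := (n : ℤ)) (b := j)]
    exact and_congr Iff.rfl (by omega)
  have e' : (((n : ℤ) ∣ c - i ∧ (n : ℤ) ∣ b - j) ∧ b - i + (c - j) = 0) ↔
      ((n : ℤ) ∣ b - j ∧ c = i + j - b) := by
    constructor
    · rintro ⟨⟨h1, h2⟩, h3⟩
      exact ⟨h2, by omega⟩
    · rintro ⟨h1, h3⟩
      have h : c - i = -(b - j) := by omega
      exact ⟨⟨h ▸ (dvd_neg.2 h1), h1⟩, by omega⟩
  have ec : (n : ℤ) ∣ i - c ↔ (n : ℤ) ∣ c - i := dvd_sub_comm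
  simp only [ec, e, e']

end Brackets

/-! ### The commutator of two quadratic terms -/

section Collapse

variable {R : Type*} [AddCommMonoid R] (g : Fin l → Fin l → Fin l → R)

theorem sum_middle : ∑ x, ∑ y, ∑ x', ∑ y', (if y = x' then g x y y' else 0) =
    ∑ x, ∑ y, ∑ z, g x y z := by
  refine Finset.sum_congr rfl fun x _ => Finset.sum_congr rfl fun y _ => ?_
  rw [Finset.sum_comm]
  simp

theorem sum_right : ∑ x, ∑ y, ∑ x', ∑ y', (if y = y' then g x y x' else 0) =
    ∑ x, ∑ y, ∑ z, g x y z := by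
  simp

theorem sum_left : ∑ x, ∑ y, ∑ x', ∑ y', (if x = x' then g x y y' else 0) =
    ∑ x, ∑ y, ∑ z, g x y z := by
  refine Finset.sum_congr rfl fun x _ => Finset.sum_congr rfl fun y _ => ?_
  rw [Finset.sum_comm]
  simp

theorem sum_outer : ∑ x, ∑ y, ∑ x', ∑ y', (if x = y' then g x y x' else 0) =
    ∑ x, ∑ y, ∑ z, g x y z := by
  simp

theorem sum_ite_const (p : Prop) [Decidable p] :
    (∑ x, ∑ y, ∑ z, if p then g x y z else 0) = if p then ∑ x, ∑ y, ∑ z, g x y z else 0 := by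
  split_ifs <;> simp

end Collapse

theorem lineTerm_commutator_expand (i j b c : ℤ) :
    lineTerm n l α i b * lineTerm n l α j c - lineTerm n l α j c * lineTerm n l α i b =
      ∑ x : Fin l, ∑ y : Fin l, ∑ x' : Fin l, ∑ y' : Fin l,
        (coef x y (b - i) * coef x' y' (c - j)) •
          (pE (n := n) α x i b * pE α y b i * (pE α x' j c * pE α y' c j)
            - pE (n := n) α x' j c * pE α y' c j * (pE α x i b * pE α y b i)) := by
  have key : ∀ G H : Fin l → Fin l → EnvHat n l α,
      (∑ x, ∑ y, G x y) * (∑ x, ∑ y, H x y) - (∑ x, ∑ y, H x y) * (∑ x, ∑ y, G x y) =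
        ∑ x, ∑ y, ∑ x', ∑ y', (G x y * H x' y' - H x' y' * G x y) := fun G H => by
    simp only [Finset.sum_sub_distrib, ← Finset.mul_sum, ← Finset.sum_mul]
  rw [lineTerm, lineTerm, key]
  refine Finset.sum_congr rfl fun x _ => Finset.sum_congr rfl fun y _ =>
    Finset.sum_congr rfl fun x' _ => Finset.sum_congr rfl fun y' _ => ?_
  rw [smul_mul_smul_comm, smul_mul_smul_comm, mul_comm (coef x' y' _), smul_sub]

/-- The contribution of the central terms with coefficient `α` to the commutator of two quadratic
terms vanishes. -/
theorem sum_central_eq_zero {i j b c : ℤ} (hij : ¬(n : ℤ) ∣ i - j) (hb : (n : ℤ) ∣ b - j)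
    (hc : c = i + j - b) :
    (∑ x : Fin l, ∑ y : Fin l, ∑ z : Fin l, (coef x y (b - i) * coef z y (c - j)) •
        (pE (n := n) α x i b * pE α z j c * ((α * (pdeg n b i : ℂ)) • 1)))
      + (∑ x : Fin l, ∑ y : Fin l, ∑ z : Fin l, (coef x y (b - i) * coef x z (c - j)) •
        ((α * (pdeg n i b : ℂ)) • 1 * pE (n := n) α z c j * pE α y b i)) = 0 := by
  have hw : b - i ≠ 0 := by
    intro h
    apply hij
    have : b = i := by omega
    rwa [← this]
  have hcj : c - j = -(b - i) := by omega
  have hd : (pdeg n i b : ℂ) = -(pdeg n b i : ℂ) := by simp only [pdeg]; push_cast; ring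
  -- On this support, translation gives E_{c,j} = E_{i,b} and E_{b,i} = E_{j,c}, so both sums run
  -- over the same monomials E_{i,b} E_{j,c} with opposite degrees as weights; the sums over the
  -- idle copy agree by `sum_coef_mul_coef`.
  have e1 : ∀ z : Fin l, pE (n := n) α z c j = pE α z i b := fun z =>
    (pE_shift' z (p := c) (q := j) (by rw [hc]; convert hb using 1; ring) (by omega)).symm
  have e2 : ∀ z : Fin l, pE (n := n) α z b i = pE α z j c := fun z =>
    pE_shift' z hb (by omega)
  have h1 : ∀ x z : Fin l, ∑ y : Fin l, (coef x y (b - i) * coef z y (c - j)) •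
        (pE (n := n) α x i b * pE α z j c * ((α * (pdeg n b i : ℂ)) • 1)) =
      ((α * (pdeg n b i : ℂ)) * ∑ y, coef x y (b - i) * coef z y (-(b - i))) •
        (pE (n := n) α x i b * pE α z j c) := fun x z => by
    rw [← Finset.sum_smul, hcj, mul_smul_comm, mul_one, smul_smul, mul_comm]
  have h2 : ∀ y z : Fin l, ∑ x : Fin l, (coef x y (b - i) * coef x z (c - j)) •
        ((α * (pdeg n i b : ℂ)) • 1 * pE (n := n) α z c j * pE α y b i) =
      (-(α * (pdeg n b i : ℂ)) * ∑ x, coef x y (b - i) * coef x z (-(b - i))) •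
        (pE (n := n) α z i b * pE α y j c) := fun y z => by
    rw [← Finset.sum_smul, hcj, e1, e2, smul_mul_assoc, smul_mul_assoc, one_mul, smul_smul,
      mul_comm, hd, mul_neg]
  have h3 : ∀ F : Fin l → Fin l → Fin l → EnvHat n l α,
      ∑ x, ∑ y, ∑ z, F x y z = ∑ x, ∑ z, ∑ y, F x y z :=
    fun F => Finset.sum_congr rfl fun x _ => Finset.sum_comm
  have h4 : ∀ F : Fin l → Fin l → Fin l → EnvHat n l α,
      ∑ x, ∑ y, ∑ z, F x y z = ∑ z, ∑ y, ∑ x, F x y z := fun F => by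
    rw [Finset.sum_comm, h3, Finset.sum_comm]
  rw [h3, h4 (fun x y z => (coef x y (b - i) * coef x z (c - j)) • _), ← Finset.sum_add_distrib]
  refine Finset.sum_eq_zero fun x _ => ?_
  rw [← Finset.sum_add_distrib]
  refine Finset.sum_eq_zero fun z _ => ?_
  rw [h1, h2, sum_coef_mul_coef x z hw, ← add_smul]
  ring_nf
  simp

theorem sum_comm_middle {i j : ℤ} (hij : ¬(n : ℤ) ∣ i - j) (b c : ℤ) :
    ∑ x : Fin l, ∑ y : Fin l, ∑ x' : Fin l, ∑ y' : Fin l,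
      (coef x y (b - i) * coef x' y' (c - j)) •
        (pE (n := n) α x i b * (pE α y b i * pE α x' j c - pE α x' j c * pE α y b i) * pE α y' c j) =
      (if ((n : ℤ) ∣ b - i ∧ (n : ℤ) ∣ c - j) ∧ c - j = b - i then
        ∑ x : Fin l, ∑ y : Fin l, ∑ z : Fin l, (coef x y (b - i) * coef y z (c - j)) •
          (pE (n := n) α x i b * ((pdeg n b i : ℂ) • 1) * pE α z c j) else 0)
      - (if (n : ℤ) ∣ b - c then
        ∑ x : Fin l, ∑ y : Fin l, ∑ z : Fin l, (coef x y (b - i) * coef y z (c - j)) •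
          (pE (n := n) α x i b * pE α y j (i + c - b) * pE α z c j) else 0) := by
  have h := sum_middle (fun x y z => (coef x y (b - i) * coef y z (c - j)) • (pE (n := n) α x i b *
    ((if ((n : ℤ) ∣ b - i ∧ (n : ℤ) ∣ c - j) ∧ c - j = b - i then
          (pdeg n b i : ℂ) • (1 : EnvHat n l α) else 0)
        - (if (n : ℤ) ∣ b - c then pE α y j (i + c - b) else 0)) * pE α z c j))
  refine Eq.trans (Finset.sum_congr rfl fun x _ => Finset.sum_congr rfl fun y _ =>
    Finset.sum_congr rfl fun x' _ => Finset.sum_congr rfl fun y' _ => ?_) (h.trans ?_)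
  · rw [comm_middle y x' b c hij]
    by_cases hs : y = x'
    · subst hs
      simp only [if_true]
    · simp only [if_neg hs, mul_zero, zero_mul, smul_zero]
  · simp only [← sum_ite_const, ← Finset.sum_sub_distrib]
    refine Finset.sum_congr rfl fun x _ => Finset.sum_congr rfl fun y _ =>
      Finset.sum_congr rfl fun z _ => ?_
    simp only [mul_sub, sub_mul, smul_sub, mul_ite, ite_mul, mul_zero,
      zero_mul, smul_ite, smul_zero]

theorem sum_comm_right (i j b c : ℤ) :
    ∑ x : Fin l, ∑ y : Fin l, ∑ x' : Fin l, ∑ y' : Fin l,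
      (coef x y (b - i) * coef x' y' (c - j)) •
        (pE (n := n) α x i b * pE α x' j c * (pE α y b i * pE α y' c j - pE α y' c j * pE α y b i)) =
      (if (n : ℤ) ∣ c - i then
        ∑ x : Fin l, ∑ y : Fin l, ∑ z : Fin l, (coef x y (b - i) * coef z y (c - j)) •
          (pE (n := n) α x i b * pE α z j c * pE α y b (j + i - c)) else 0)
      - (if (n : ℤ) ∣ b - j then
        ∑ x : Fin l, ∑ y : Fin l, ∑ z : Fin l, (coef x y (b - i) * coef z y (c - j)) •
          (pE (n := n) α x i b * pE α z j c * pE α y c (i + j - b)) else 0)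
      + ((if (n : ℤ) ∣ b - j ∧ c = i + j - b then
        ∑ x : Fin l, ∑ y : Fin l, ∑ z : Fin l, (coef x y (b - i) * coef z y (c - j)) •
          (pE (n := n) α x i b * pE α z j c * ((α * (pdeg n b i : ℂ)) • 1)) else 0)
      + (if ((n : ℤ) ∣ b - i ∧ (n : ℤ) ∣ c - j) ∧ c - j = -(b - i) then
        ∑ x : Fin l, ∑ y : Fin l, ∑ z : Fin l, (coef x y (b - i) * coef z y (c - j)) •
          (pE (n := n) α x i b * pE α z j c * ((pdeg n b i : ℂ) • 1)) else 0)) := by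
  have h := sum_right (fun x y z => (coef x y (b - i) * coef z y (c - j)) • (pE (n := n) α x i b * pE α z j c *
    ((if (n : ℤ) ∣ c - i then pE α y b (j + i - c) else 0)
        - (if (n : ℤ) ∣ b - j then pE α y c (i + j - b) else 0)
        + ((if (n : ℤ) ∣ b - j ∧ c = i + j - b then
            (α * (pdeg n b i : ℂ)) • (1 : EnvHat n l α) else 0)
          + (if ((n : ℤ) ∣ b - i ∧ (n : ℤ) ∣ c - j) ∧ c - j = -(b - i) then
            (pdeg n b i : ℂ) • (1 : EnvHat n l α) else 0)))))
  refine Eq.trans (Finset.sum_congr rfl fun x _ => Finset.sum_congr rfl fun y _ =>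
    Finset.sum_congr rfl fun x' _ => Finset.sum_congr rfl fun y' _ => ?_) (h.trans ?_)
  · rw [comm_right y y' b c]
    by_cases hs : y = y'
    · subst hs
      simp only [if_true]
    · simp only [if_neg hs, mul_zero, smul_zero]
  · simp only [← sum_ite_const, ← Finset.sum_add_distrib, ← Finset.sum_sub_distrib]
    refine Finset.sum_congr rfl fun x _ => Finset.sum_congr rfl fun y _ =>
      Finset.sum_congr rfl fun z _ => ?_
    simp only [mul_add, mul_sub, smul_add, smul_sub, mul_ite, mul_zero,
      smul_ite, smul_zero]

theorem sum_comm_left (i j b c : ℤ) :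
    ∑ x : Fin l, ∑ y : Fin l, ∑ x' : Fin l, ∑ y' : Fin l,
      (coef x y (b - i) * coef x' y' (c - j)) •
        ((pE (n := n) α x i b * pE α x' j c - pE α x' j c * pE α x i b) * pE α y' c j * pE α y b i) =
      (if (n : ℤ) ∣ b - j then
        ∑ x : Fin l, ∑ y : Fin l, ∑ z : Fin l, (coef x y (b - i) * coef x z (c - j)) •
          (pE (n := n) α x i (c + b - j) * pE α z c j * pE α y b i) else 0)
      - (if (n : ℤ) ∣ c - i then
        ∑ x : Fin l, ∑ y : Fin l, ∑ z : Fin l, (coef x y (b - i) * coef x z (c - j)) •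
          (pE (n := n) α x j (b + c - i) * pE α z c j * pE α y b i) else 0)
      + ((if (n : ℤ) ∣ b - j ∧ c = i + j - b then
        ∑ x : Fin l, ∑ y : Fin l, ∑ z : Fin l, (coef x y (b - i) * coef x z (c - j)) •
          ((α * (pdeg n i b : ℂ)) • 1 * pE (n := n) α z c j * pE α y b i) else 0)
      + (if ((n : ℤ) ∣ b - i ∧ (n : ℤ) ∣ c - j) ∧ c - j = -(b - i) then
        ∑ x : Fin l, ∑ y : Fin l, ∑ z : Fin l, (coef x y (b - i) * coef x z (c - j)) •
          ((pdeg n i b : ℂ) • 1 * pE (n := n) α z c j * pE α y b i) else 0)) := by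
  have h := sum_left (fun x y z => (coef x y (b - i) * coef x z (c - j)) • (
    ((if (n : ℤ) ∣ b - j then pE α x i (c + b - j) else 0)
        - (if (n : ℤ) ∣ c - i then pE α x j (b + c - i) else 0)
        + ((if (n : ℤ) ∣ b - j ∧ c = i + j - b then
            (α * (pdeg n i b : ℂ)) • (1 : EnvHat n l α) else 0)
          + (if ((n : ℤ) ∣ b - i ∧ (n : ℤ) ∣ c - j) ∧ c - j = -(b - i) then
            (pdeg n i b : ℂ) • (1 : EnvHat n l α) else 0)))
      * pE (n := n) α z c j * pE α y b i))
  refine Eq.trans (Finset.sum_congr rfl fun x _ => Finset.sum_congr rfl fun y _ =>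
    Finset.sum_congr rfl fun x' _ => Finset.sum_congr rfl fun y' _ => ?_) (h.trans ?_)
  · rw [comm_left x x' b c]
    by_cases hs : x = x'
    · subst hs
      simp only [if_true]
    · simp only [if_neg hs, zero_mul, smul_zero]
  · simp only [← sum_ite_const, ← Finset.sum_add_distrib, ← Finset.sum_sub_distrib]
    refine Finset.sum_congr rfl fun x _ => Finset.sum_congr rfl fun y _ =>
      Finset.sum_congr rfl fun z _ => ?_
    simp only [add_mul, sub_mul, smul_add, smul_sub, ite_mul,
      zero_mul, smul_ite, smul_zero]

theorem sum_comm_outer {i j : ℤ} (hij : ¬(n : ℤ) ∣ i - j) (b c : ℤ) :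
    ∑ x : Fin l, ∑ y : Fin l, ∑ x' : Fin l, ∑ y' : Fin l,
      (coef x y (b - i) * coef x' y' (c - j)) •
        (pE (n := n) α x' j c * (pE α x i b * pE α y' c j - pE α y' c j * pE α x i b) * pE α y b i) =
      (if ((n : ℤ) ∣ b - i ∧ (n : ℤ) ∣ c - j) ∧ c - j = b - i then
        ∑ x : Fin l, ∑ y : Fin l, ∑ z : Fin l, (coef x y (b - i) * coef z x (c - j)) •
          (pE (n := n) α z j c * ((pdeg n i b : ℂ) • 1) * pE α y b i) else 0)
      + (if (n : ℤ) ∣ b - c then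
        ∑ x : Fin l, ∑ y : Fin l, ∑ z : Fin l, (coef x y (b - i) * coef z x (c - j)) •
          (pE (n := n) α z j c * pE α x i (j + b - c) * pE α y b i) else 0) := by
  have h := sum_outer (fun x y z => (coef x y (b - i) * coef z x (c - j)) • (pE (n := n) α z j c *
    ((if ((n : ℤ) ∣ b - i ∧ (n : ℤ) ∣ c - j) ∧ c - j = b - i then
          (pdeg n i b : ℂ) • (1 : EnvHat n l α) else 0)
        + (if (n : ℤ) ∣ b - c then pE α x i (j + b - c) else 0)) * pE α y b i))
  refine Eq.trans (Finset.sum_congr rfl fun x _ => Finset.sum_congr rfl fun y _ =>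
    Finset.sum_congr rfl fun x' _ => Finset.sum_congr rfl fun y' _ => ?_) (h.trans ?_)
  · rw [comm_outer x y' b c hij]
    by_cases hs : x = y'
    · subst hs
      simp only [if_true]
    · simp only [if_neg hs, mul_zero, zero_mul, smul_zero]
  · simp only [← sum_ite_const, ← Finset.sum_add_distrib]
    refine Finset.sum_congr rfl fun x _ => Finset.sum_congr rfl fun y _ =>
      Finset.sum_congr rfl fun z _ => ?_
    simp only [mul_add, add_mul, smul_add, mul_ite, ite_mul, mul_zero,
      zero_mul, smul_ite, smul_zero]

/-- The central contributions to the commutator of two quadratic terms. -/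
def central₁ (α : ℂ) (l : ℕ) (i j b c : ℤ) : EnvHat n l α :=
  ∑ x : Fin l, ∑ y, ∑ z, ((coef x y (b - i) * coef y z (c - j) * (pdeg n b i : ℂ)) •
      (pE (n := n) α x i b * pE α z c j)
    + (coef x y (b - i) * coef z x (c - j) * (pdeg n i b : ℂ)) •
      (pE (n := n) α z j c * pE α y b i))

/-- Central contributions, as `central₁`. -/
def central₂ (α : ℂ) (l : ℕ) (i j b c : ℤ) : EnvHat n l α :=
  ∑ x : Fin l, ∑ y, ∑ z, ((coef x y (b - i) * coef z y (c - j) * (pdeg n b i : ℂ)) •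
      (pE (n := n) α x i b * pE α z j c)
    + (coef x y (b - i) * coef x z (c - j) * (pdeg n i b : ℂ)) •
      (pE (n := n) α z c j * pE α y b i))

theorem ite_sub_zero {R : Type*} [AddGroup R] (p : Prop) [Decidable p] (a b : R) :
    (if p then a - b else 0) = (if p then a else 0) - (if p then b else 0) := by
  split_ifs <;> simp

/-- The commutator of two quadratic terms, with the cubic and the central contributions
separated. -/
theorem lineTerm_commutator {i j : ℤ} (hij : ¬(n : ℤ) ∣ i - j) (b c : ℤ) :
    lineTerm n l α i b * lineTerm n l α j c - lineTerm n l α j c * lineTerm n l α i b =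
      (if (n : ℤ) ∣ b - j then
        ∑ x, ∑ y, ∑ z, ((coef x y (b - i) * coef x z (c - j)) •
            (pE (n := n) α x i (c + b - j) * pE α z c j * pE α y b i)
          - (coef x y (b - i) * coef z y (c - j)) •
            (pE (n := n) α x i b * pE α z j c * pE α y c (i + j - b))) else 0)
      + (if (n : ℤ) ∣ c - i then
        ∑ x, ∑ y, ∑ z, ((coef x y (b - i) * coef z y (c - j)) •
            (pE (n := n) α x i b * pE α z j c * pE α y b (j + i - c))
          - (coef x y (b - i) * coef x z (c - j)) •
            (pE (n := n) α x j (b + c - i) * pE α z c j * pE α y b i)) else 0)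
      + (if (n : ℤ) ∣ b - c then
        ∑ x, ∑ y, ∑ z, ((coef x y (b - i) * coef z x (c - j)) •
            (pE (n := n) α z j c * pE α x i (j + b - c) * pE α y b i)
          - (coef x y (b - i) * coef y z (c - j)) •
            (pE (n := n) α x i b * pE α y j (i + c - b) * pE α z c j)) else 0)
      + (if ((n : ℤ) ∣ b - i ∧ (n : ℤ) ∣ c - j) ∧ c - j = b - i then
        central₁ α l i j b c else 0)
      + (if ((n : ℤ) ∣ b - i ∧ (n : ℤ) ∣ c - j) ∧ c - j = -(b - i) then
        central₂ α l i j b c else 0) := by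
  rw [lineTerm_commutator_expand, central₁, central₂]
  simp only [mul_commutator, smul_add, Finset.sum_add_distrib]
  rw [sum_comm_middle hij, sum_comm_right, sum_comm_left, sum_comm_outer hij]
  have h0 := sum_central_eq_zero (n := n) (l := l) (α := α) (b := b) (c := c) hij
  simp only [Finset.sum_sub_distrib, smul_mul_assoc, mul_smul_comm,
    smul_smul, mul_one, one_mul] at h0 ⊢
  have h1 : ∀ X Y : EnvHat n l α, (((n : ℤ) ∣ b - j) → c = i + j - b → X + Y = 0) →
      (if (n : ℤ) ∣ b - j ∧ c = i + j - b then X else 0)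
        + (if (n : ℤ) ∣ b - j ∧ c = i + j - b then Y else 0) = 0 := fun X Y h => by
    split_ifs with h2
    · exact h h2.1 h2.2
    · exact add_zero 0
  have h2 := h1 _ _ h0
  simp only [ite_sub_zero, ite_add_zero]
  linear_combination (norm := abel) h2

end RectW
end

noncomputable section

namespace RectW

open Filter Topology UniformSpace

variable {n l : ℕ} {α : ℂ} [NeZero n]

/-! ### Cancellation of the cubic terms -/

/-- The indicator function of the negative integers. -/
def negInd (x : ℤ) : ℂ := if x < 0 then 1 else 0

theorem coef_self (A : Fin l) (x : ℤ) : coef A A x = -negInd x := by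
  simp [coef, negInd]

/-- Distinct copies commute, so putting the factors into a standard order costs a commutator only
when the copies coincide. These corrections are all that survives of the cubic terms. -/
theorem mul_mul_swap (A B C : Fin l) (p q r s t u : ℤ) :
    pE (n := n) α A p q * pE α C r s * pE α B t u =
      pE (n := n) α A p q * pE α B t u * pE α C r s
        - if B = C then pE (n := n) α A p q * (pE α B t u * pE α B r s - pE α B r s * pE α B t u)
          else 0 := by
  split_ifs with h
  · subst h
    noncomm_ring
  · rw [mul_assoc, pE_commute (Ne.symm h), ← mul_assoc, sub_zero]

theorem mul_mul_swap' (A B C : Fin l) (p q r s t u : ℤ) :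
    pE (n := n) α B r s * pE α A p q * pE α C t u =
      pE (n := n) α A p q * pE α B r s * pE α C t u
        - if A = B then (pE (n := n) α A p q * pE α A r s - pE α A r s * pE α A p q) * pE α C t u
          else 0 := by
  split_ifs with h
  · subst h
    noncomm_ring
  · rw [pE_commute (Ne.symm h), sub_zero]

/-- These three families run along r → c → j → r. With copies A, B, C on the successive edges,
`coef_cyclic` for u = j - r, v = c - j kills the common monomial; the correction for B = C remains.
-/
theorem sum_cubic_path {j r : ℤ} (hrj : r ≠ j) (c : ℤ) :
    ∑ x : Fin l, ∑ y : Fin l, ∑ z : Fin l, (cubic₄ (n := n) α j x y z r c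
      + cubic₂ α j x y z r c - cubic₁ α j x y z r c) =
    ∑ A : Fin l, ∑ B : Fin l, (coef A B (c - r) * (negInd (r - j) - negInd (c - j))) •
      (pE (n := n) α A r c * (pE α B c j * pE α B j r - pE α B j r * pE α B c j)) := by
  refine Finset.sum_congr rfl fun A _ => ?_
  have h : ∀ F G H : Fin l → Fin l → EnvHat n l α, ∑ y, ∑ z, (F y z + G y z - H y z) =
      ∑ y, ∑ z, (F z y + G y z - H z y) := fun F G H => by
    simp only [Finset.sum_add_distrib, Finset.sum_sub_distrib]
    rw [Finset.sum_comm (f := F), Finset.sum_comm (f := H)]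
  rw [h]
  refine Finset.sum_congr rfl fun B _ => ?_
  have h2 : ∀ C : Fin l, cubic₄ (n := n) α j A C B r c + cubic₂ α j A B C r c
      - cubic₁ α j A C B r c = if B = C then
        (coef A B (c - r) * (negInd (r - j) - negInd (c - j))) •
          (pE (n := n) α A r c * (pE α B c j * pE α B j r - pE α B j r * pE α B c j)) else 0 := by
    intro C
    have hc := coef_cyclic A B C (u := j - r) (c - j) (by omega)
    rw [show j - r + (c - j) = c - r by ring, neg_sub] at hc
    rw [cubic₄, cubic₂, cubic₁, mul_mul_swap A B C r c j r c j]
    generalize pE (n := n) α A r c * pE α B c j * pE α C j r = M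
    split_ifs with hBC
    · subst hBC
      generalize pE (n := n) α A r c * (pE α B c j * pE α B j r - pE α B j r * pE α B c j) = K
      simp only [coef_self] at hc ⊢
      linear_combination (norm := module) hc • M
    · rw [sub_zero]
      linear_combination (norm := module) hc • M
  rw [Finset.sum_congr rfl fun C _ => h2 C, Finset.sum_ite_eq]
  simp

/-- The other three families run along r → j → c → r; here `coef_cyclic'` applies and the correction
occurs for A = B. -/
theorem sum_cubic_path' {j r : ℤ} (hrj : r ≠ j) (c : ℤ) :
    ∑ x : Fin l, ∑ y : Fin l, ∑ z : Fin l, (cubic₆ (n := n) α j x y z r c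
      - cubic₃ α j x y z r c - cubic₅ α j x y z r c) =
    -∑ A : Fin l, ∑ B : Fin l, (coef A B (c - r) * (negInd (r - j) - negInd (c - j))) •
      ((pE (n := n) α A r j * pE α A j c - pE α A j c * pE α A r j) * pE α B c r) := by
  have h : ∀ F G H : Fin l → Fin l → Fin l → EnvHat n l α,
      ∑ x, ∑ y, ∑ z, (F x y z - G x y z - H x y z) =
      ∑ A, ∑ C, ∑ B, (F A C B - G A C B - H B C A) := fun F G H => by
    simp only [Finset.sum_sub_distrib]
    congr 1
    rw [Finset.sum_comm, Finset.sum_comm (γ := Fin l) (f := fun A C => ∑ B, H B C A)]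
    refine Finset.sum_congr rfl fun C _ => ?_
    rw [Finset.sum_comm]
  rw [h, ← Finset.sum_neg_distrib]
  refine Finset.sum_congr rfl fun A _ => ?_
  rw [← Finset.sum_neg_distrib]
  refine Finset.sum_congr rfl fun C _ => ?_
  have h2 : ∀ B : Fin l, cubic₆ (n := n) α j A C B r c - cubic₃ α j A C B r c
      - cubic₅ α j B C A r c = if A = B then
        -((coef A C (c - r) * (negInd (r - j) - negInd (c - j))) •
      ((pE (n := n) α A r j * pE α A j c - pE α A j c * pE α A r j) * pE α C c r)) else 0 := by
    intro B
    have hc := coef_cyclic' A B C (u := j - r) (c - j) (by omega)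
    rw [show j - r + (c - j) = c - r by ring, neg_sub] at hc
    rw [cubic₆, cubic₃, cubic₅, mul_mul_swap' A B C r j j c c r]
    generalize pE (n := n) α A r j * pE α B j c * pE α C c r = M
    split_ifs with hAB
    · subst hAB
      generalize (pE (n := n) α A r j * pE α A j c - pE α A j c * pE α A r j) * pE α C c r = K
      simp only [coef_self] at hc ⊢
      linear_combination (norm := module) hc • M
    · rw [sub_zero]
      linear_combination (norm := module) hc • M
  rw [Finset.sum_congr rfl fun C _ => h2 C, Finset.sum_ite_eq]
  simp

/-- The sum of the cubic terms of the commutator of two quadratic series is quadratic. -/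
theorem sum_cubic {j r : ℤ} (hrj : ¬(n : ℤ) ∣ r - j) (c : ℤ) :
    ∑ x : Fin l, ∑ y : Fin l, ∑ z : Fin l, ((cubic₄ (n := n) α j x y z r c
      - cubic₃ α j x y z r c) + (cubic₂ α j x y z r c - cubic₅ α j x y z r c)
      + (cubic₆ α j x y z r c - cubic₁ α j x y z r c)) =
    if (n : ℤ) ∣ c - r then ∑ A : Fin l, ∑ B : Fin l,
      (coef A B (c - r) * (negInd (c - j) - negInd (r - j))) •
      (pE (n := n) α A r c * pE α B j (j + r - c) - pE (n := n) α A j (j + c - r) * pE α B c r)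
    else 0 := by
  have hne : r ≠ j := by
    rintro rfl
    simp at hrj
  have h1 := sum_cubic_path (n := n) (l := l) (α := α) hne c
  have h2 := sum_cubic_path' (n := n) (l := l) (α := α) hne c
  have h3 : ∀ x y z : Fin l, ((cubic₄ (n := n) α j x y z r c
      - cubic₃ α j x y z r c) + (cubic₂ α j x y z r c - cubic₅ α j x y z r c)
      + (cubic₆ α j x y z r c - cubic₁ α j x y z r c)) =
      (cubic₄ (n := n) α j x y z r c + cubic₂ α j x y z r c - cubic₁ α j x y z r c)
      + (cubic₆ (n := n) α j x y z r c - cubic₃ α j x y z r c - cubic₅ α j x y z r c) := by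
    intro x y z
    abel
  simp only [h3]
  have h5 : ∀ F G : Fin l → Fin l → Fin l → EnvHat n l α,
      ∑ x, ∑ y, ∑ z, (F x y z + G x y z) = ∑ x, ∑ y, ∑ z, F x y z + ∑ x, ∑ y, ∑ z, G x y z :=
    fun F G => by simp only [Finset.sum_add_distrib]
  rw [h5]
  rw [h1, h2, ← sub_eq_add_neg, ← Finset.sum_sub_distrib]
  have hjr : ¬(n : ℤ) ∣ j - r := fun h => hrj (dvd_sub_comm.1 h)
  -- At c = r the weight vanishes. For c ≠ r the total displacement is nonzero, so the commutators
  -- below have no central term with α.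
  by_cases hcr : c = r
  · subst hcr
    simp
  -- The linear terms E_{c,r} and E_{r,c} produce E_{r,c} E_{c,r} once from each cycle, with
  -- opposite signs; only the terms requiring c ≡ r are left.
  have e : ∀ A B : Fin l, pE (n := n) α A r c * (pE α B c j * pE α B j r - pE α B j r * pE α B c j)
      - (pE (n := n) α A r j * pE α A j c - pE α A j c * pE α A r j) * pE α B c r =
      if (n : ℤ) ∣ c - r then -(pE (n := n) α A r c * pE α B j (j + r - c)
        - pE (n := n) α A j (j + c - r) * pE α B c r) else 0 := by
    intro A B
    rw [pE_comm, pE_comm, if_pos rfl, if_pos rfl,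
      if_neg (c := ((n : ℤ) ∣ c - r ∧ (n : ℤ) ∣ j - j) ∧ _) (by omega),
      if_neg (c := ((n : ℤ) ∣ r - c ∧ (n : ℤ) ∣ j - j) ∧ _) (by omega),
      if_neg (c := ((n : ℤ) ∣ c - j ∧ (n : ℤ) ∣ j - r) ∧ _) (by tauto),
      if_neg (c := ((n : ℤ) ∣ r - j ∧ (n : ℤ) ∣ j - c) ∧ _) (by tauto),
      if_pos (c := (n : ℤ) ∣ j - j) (by simp), if_pos (c := (n : ℤ) ∣ j - j) (by simp)]
    have ec : (n : ℤ) ∣ r - c ↔ (n : ℤ) ∣ c - r := dvd_sub_comm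
    simp only [ec, add_zero, add_sub_cancel_right]
    split_ifs
    · noncomm_ring
    · simp
  have h4 : ∀ A : Fin l, (∑ B : Fin l, (coef A B (c - r) * (negInd (r - j) - negInd (c - j))) •
      (pE (n := n) α A r c * (pE α B c j * pE α B j r - pE α B j r * pE α B c j)))
      - (∑ B : Fin l, (coef A B (c - r) * (negInd (r - j) - negInd (c - j))) •
      ((pE (n := n) α A r j * pE α A j c - pE α A j c * pE α A r j) * pE α B c r)) =
      if (n : ℤ) ∣ c - r then ∑ B : Fin l,
      (coef A B (c - r) * (negInd (c - j) - negInd (r - j))) •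
      (pE (n := n) α A r c * pE α B j (j + r - c) - pE (n := n) α A j (j + c - r) * pE α B c r)
      else 0 := by
    intro A
    rw [← Finset.sum_sub_distrib]
    simp only [← smul_sub, e]
    split_ifs
    · refine Finset.sum_congr rfl fun B _ => ?_
      rw [smul_neg, ← neg_smul]
      congr 1
      ring
    · simp
  rw [Finset.sum_congr rfl fun A _ => h4 A]
  split_ifs <;> simp

end RectW
end

/-! ### Reindexing and summation tools -/

noncomputable section

namespace RectW

open Filter Topology UniformSpace

/-- Reindexing of a sum over the range of an injective map. -/
theorem hasSum_ite_range {ι κ R : Type*} [AddCommMonoid R] [TopologicalSpace R] {T : ι → κ}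
    (hT : Function.Injective T) (p : κ → Prop) [DecidablePred p] (hp : ∀ q, p q ↔ q ∈ Set.range T)
    {F : κ → R} {G : ι → R} (hG : ∀ x, F (T x) = G x) {S : R} :
    HasSum (fun q => if p q then F q else 0) S ↔ HasSum G S := by
  rw [← hT.hasSum_iff fun q hq => if_neg fun h => hq ((hp q).1 h)]
  have : (fun q => if p q then F q else 0) ∘ T = G := by
    funext x
    simp [(hp (T x)).2 ⟨x, rfl⟩, hG]
  rw [this]

/-- The difference of the indicator functions of two half-lines sums to the signed distance of
their end points. -/
theorem hasSum_indicator_sub {R : Type*} [AddCommGroup R] [Module ℂ R] [TopologicalSpace R]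
    (v k : ℤ) (X : R) :
    HasSum (fun u : ℤ => ((if u + k < v then 1 else 0) - (if u < v then 1 else 0) : ℂ) • X)
      ((-k : ℂ) • X) := by
  have key : ∀ (a b : ℤ) (e : ℂ), (∀ u, ((if u + k < v then 1 else 0) - (if u < v then 1 else 0) : ℂ)
      = if u ∈ Finset.Ico a b then e else 0) → ((b - a).toNat : ℂ) * e = -k →
      HasSum (fun u : ℤ => ((if u + k < v then 1 else 0) - (if u < v then 1 else 0) : ℂ) • X)
      ((-k : ℂ) • X) := by
    intro a b e h he
    have h2 := hasSum_sum_of_ne_finset_zero (L := .unconditional ℤ) (s := Finset.Ico a b)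
      (f := fun u : ℤ => ((if u + k < v then 1 else 0) - (if u < v then 1 else 0) : ℂ) • X)
      (fun u hu => by rw [h, if_neg hu, zero_smul])
    rw [← Finset.sum_smul, Finset.sum_congr rfl (g := fun _ => e)
      (fun u hu => by rw [h, if_pos hu]), Finset.sum_const, Int.card_Ico, nsmul_eq_mul, he] at h2
    exact h2
  have hcast : ∀ a : ℤ, 0 ≤ a → (a.toNat : ℂ) = a := fun a ha => by
    have : ((a.toNat : ℤ) : ℂ) = a := by rw [Int.toNat_of_nonneg ha]
    exact_mod_cast this
  rcases le_total 0 k with hk | hk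
  · refine key (v - k) v (-1) (fun u => ?_) ?_
    · simp only [Finset.mem_Ico]
      split_ifs <;> first | omega | simp
    · rw [hcast _ (by omega)]
      push_cast
      ring
  · refine key v (v - k) 1 (fun u => ?_) ?_
    · simp only [Finset.mem_Ico]
      split_ifs <;> first | omega | simp
    · rw [hcast _ (by omega)]
      push_cast
      ring

theorem summable_cubic {n l : ℕ} {α : ℂ} {F : Fin l → Fin l → Fin l → ℤ × ℤ → EnvHat n l α}
    {G : Fin l → Fin l → Fin l → ℤ × ℤ → EnvHat n l α}
    (hF : ∀ x y z, Tendsto (F x y z) cofinite (𝓝 0))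
    (hG : ∀ x y z, Tendsto (G x y z) cofinite (𝓝 0)) :
    Summable fun q => ∑ x, ∑ y, ∑ z, (F x y z q - G x y z q) :=
  summable_sum fun x _ => summable_sum fun y _ => summable_sum fun z _ =>
    (summable_of_null (hF x y z)).sub (summable_of_null (hG x y z))

variable {n l : ℕ} {α : ℂ} [NeZero n]

/-! ### The quadratic series commute -/

/-- The quadratic terms left over from the cubic and the central terms. -/
def cartanTerm (n l : ℕ) (α : ℂ) [NeZero n] (i j k : ℤ) : EnvHat n l α :=
  ∑ A : Fin l, ∑ B : Fin l, coef A B (n * k) •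
    (pE (n := n) α A i (i + n * k) * pE α B j (j - n * k)
      - pE (n := n) α A j (j + n * k) * pE α B i (i - n * k))

/-- The family of cubic terms in the commutator of two quadratic series. -/
def cubicFamily (n l : ℕ) (α : ℂ) [NeZero n] (j r c : ℤ) : EnvHat n l α :=
  ∑ x : Fin l, ∑ y : Fin l, ∑ z : Fin l, ((cubic₄ (n := n) α j x y z r c
      - cubic₃ α j x y z r c) + (cubic₂ α j x y z r c - cubic₅ α j x y z r c)
      + (cubic₆ α j x y z r c - cubic₁ α j x y z r c))

/-- As i ≢ j, the value nu = j - i never occurs, so nu < j - i is the same as u ≤ ⌊(j - i)/n⌋. -/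
theorem negInd_shift {i j : ℤ} (hij : ¬(n : ℤ) ∣ i - j) (u : ℤ) :
    negInd (i + n * u - j) = if u < (j - i) / n + 1 then 1 else 0 := by
  rw [negInd]
  refine if_congr ?_ rfl rfl
  have hn := natCast_pos' n
  rw [Int.lt_add_one_iff, Int.le_ediv_iff_mul_le hn, mul_comm u]
  have : (n : ℤ) * u ≠ j - i := fun h => hij ⟨-u, by linarith⟩
  omega

theorem cubicFamily_eq {i j : ℤ} (hij : ¬(n : ℤ) ∣ i - j) (u c : ℤ) :
    cubicFamily n l α j (i + n * u) c = if (n : ℤ) ∣ c - (i + n * u) then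
      ∑ A : Fin l, ∑ B : Fin l,
      (coef A B (c - (i + n * u)) * (negInd (c - j) - negInd (i + n * u - j))) •
      (pE (n := n) α A (i + n * u) c * pE α B j (j + (i + n * u) - c)
        - pE (n := n) α A j (j + c - (i + n * u)) * pE α B c (i + n * u))
    else 0 := by
  refine sum_cubic (fun h => hij ?_) c
  have h2 := dvd_sub h (dvd_mul_right (n : ℤ) u)
  rwa [show i + n * u - j - n * u = i - j by ring] at h2

/-- On the support, r = i + nu and c = i + n(u + k). By periodicity the monomials depend on k alone,
and summing the difference of indicators over u gives -k. -/
theorem hasSum_cartanTerm_of_hasSum {i j : ℤ} (hij : ¬(n : ℤ) ∣ i - j) {S : EnvHat n l α}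
    (h : HasSum (fun q : ℤ × ℤ => cubicFamily n l α j (i + n * q.1) q.2) S) :
    HasSum (fun k : ℤ => (-(k : ℂ)) • cartanTerm n l α i j k) S := by
  simp only [cubicFamily_eq hij] at h
  have hT : Function.Injective fun q : ℤ × ℤ => (q.2, i + n * (q.2 + q.1)) := by
    rintro ⟨a, b⟩ ⟨a', b'⟩ h
    simp only [Prod.mk.injEq, add_right_inj, mul_eq_mul_left_iff] at h
    obtain ⟨rfl, h | h⟩ := h
    · exact Prod.ext (by simpa using h) rfl
    · exact absurd h (natCast_ne_zero' n)
  rw [hasSum_ite_range hT (fun q => (n : ℤ) ∣ q.2 - (i + n * q.1)) (F := fun q =>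
    ∑ A : Fin l, ∑ B : Fin l,
      (coef A B (q.2 - (i + n * q.1)) * (negInd (q.2 - j) - negInd (i + n * q.1 - j))) •
      (pE (n := n) α A (i + n * q.1) q.2 * pE α B j (j + (i + n * q.1) - q.2)
        - pE (n := n) α A j (j + q.2 - (i + n * q.1)) * pE α B q.2 (i + n * q.1))) (G := fun q =>
    (((if q.2 + q.1 < (j - i) / n + 1 then 1 else 0) - (if q.2 < (j - i) / n + 1 then 1 else 0) :
      ℂ)) • cartanTerm n l α i j q.1)] at h
  · refine h.prod_fiberwise fun k => ?_
    exact hasSum_indicator_sub _ _ _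
  · rintro ⟨u, c⟩
    constructor
    · rintro ⟨k, hk⟩
      refine ⟨(k, u), Prod.ext rfl ?_⟩
      dsimp only at hk ⊢
      linarith
    · rintro ⟨⟨k, u'⟩, h⟩
      obtain ⟨rfl, rfl⟩ := Prod.ext_iff.1 h
      exact ⟨k, by dsimp only; ring⟩
  · rintro ⟨k, u⟩
    dsimp only
    rw [negInd_shift hij, negInd_shift hij, cartanTerm, Finset.smul_sum]
    refine Finset.sum_congr rfl fun A _ => ?_
    rw [Finset.smul_sum]
    refine Finset.sum_congr rfl fun B _ => ?_
    rw [pE_shift A (p := i) (q := i + n * k) u rfl (by ring),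
      pE_shift B (p := i) (q := i - n * k) (p' := i + n * (u + k)) (k := u + k) (by ring) (by ring),
      smul_smul, show i + n * (u + k) - (i + n * u) = n * k by ring,
      show j + (i + n * u) - (i + n * (u + k)) = j - n * k by ring,
      show j + (i + n * (u + k)) - (i + n * u) = j + n * k by ring, mul_comm]

/-- At b = i + nk the central weights are ±k, and both central sums involve the same monomials after
translation. Summing over the idle copy, `coef_add_coef_neg` collapses a product of two coefficients
to a single one. -/
theorem central_add_central {i j : ℤ} (k : ℤ) :
    central₁ (n := n) α l i j (i + n * k) (j + n * k) + central₂ α l i j (i + n * k) (j - n * k) =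
      (k : ℂ) • cartanTerm n l α i j k := by
  by_cases hk : k = 0
  · subst hk
    simp [central₁, central₂, pdeg_self]
  have hw : (n : ℤ) * k ≠ 0 := mul_ne_zero (natCast_ne_zero' n) hk
  have hd1 : pdeg n (i + n * k) i = -k := by rw [pdeg, div_shift k rfl]; ring
  have hd2 : pdeg n i (i + n * k) = k := by rw [pdeg, div_shift k rfl]; ring
  have e1 : ∀ z : Fin l, pE (n := n) α z (j + n * k) j = pE α z j (j - n * k) := fun z =>
    pE_shift z k rfl (by ring)
  have e2 : ∀ z : Fin l, pE (n := n) α z (j - n * k) j = pE α z j (j + n * k) := fun z =>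
    pE_shift z (-k) (by ring) (by ring)
  have e3 : ∀ z : Fin l, pE (n := n) α z (i + n * k) i = pE α z i (i - n * k) := fun z =>
    pE_shift z k rfl (by ring)
  have h : ∀ F F' G G' : Fin l → Fin l → Fin l → EnvHat n l α,
      (∑ x, ∑ y, ∑ z, (F x y z + G x y z)) + (∑ x, ∑ y, ∑ z, (F' x y z + G' x y z)) =
      ∑ A, ∑ B, ((∑ y, (F A y B + F' A y B)) + ∑ x, (G x B A + G' x B A)) := by
    intro F F' G G'
    have a1 : ∀ F : Fin l → Fin l → Fin l → EnvHat n l α,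
      ∑ x, ∑ y, ∑ z, F x y z = ∑ A, ∑ B, ∑ y, F A y B :=
      fun F => Finset.sum_congr rfl fun x _ => Finset.sum_comm
    have a2 : ∀ F : Fin l → Fin l → Fin l → EnvHat n l α,
      ∑ x, ∑ y, ∑ z, F x y z = ∑ A, ∑ B, ∑ x, F x B A := fun F => by
      rw [Finset.sum_comm, a1, Finset.sum_comm]
    simp only [Finset.sum_add_distrib]
    rw [a1 F, a1 F', a2 G, a2 G']
    abel
  rw [central₁, central₂, h, cartanTerm, Finset.smul_sum]
  refine Finset.sum_congr rfl fun A _ => ?_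
  rw [Finset.smul_sum]
  refine Finset.sum_congr rfl fun B _ => ?_
  simp only [e1, e2, e3, hd1, hd2, add_sub_cancel_left, sub_sub_cancel_left, ← add_smul,
    ← Finset.sum_smul]
  have s1 : ∑ y : Fin l, (coef A y (n * k) * coef y B (n * k) * ((-k : ℤ) : ℂ)
      + coef A y (n * k) * coef B y (-(n * k)) * ((-k : ℤ) : ℂ)) = k * coef A B (n * k) := by
    have : ∀ y : Fin l, coef A y (n * k) * coef y B (n * k) * ((-k : ℤ) : ℂ)
      + coef A y (n * k) * coef B y (-(n * k)) * ((-k : ℤ) : ℂ) =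
      if y = B then k * coef A y (n * k) else 0 := fun y => by
      have := coef_add_coef_neg y B hw
      split_ifs at this ⊢ <;> push_cast <;>
        linear_combination (-(k : ℂ) * coef A y (n * k)) * this
    rw [Finset.sum_congr rfl fun y _ => this y]
    simp
  have s2 : ∑ x : Fin l, (coef x B (n * k) * coef A x (n * k) * (k : ℂ)
      + coef x B (n * k) * coef x A (-(n * k)) * (k : ℂ)) = -(k * coef A B (n * k)) := by
    have : ∀ x : Fin l, coef x B (n * k) * coef A x (n * k) * (k : ℂ)
      + coef x B (n * k) * coef x A (-(n * k)) * (k : ℂ) =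
      if A = x then -(k * coef x B (n * k)) else 0 := fun x => by
      have := coef_add_coef_neg A x hw
      split_ifs at this ⊢ <;>
        linear_combination ((k : ℂ) * coef x B (n * k)) * this
    rw [Finset.sum_congr rfl fun y _ => this y]
    simp
  rw [s1, s2]
  module

/-- The sum of the quadratic series attached to `i`. -/
def lineSum (n l : ℕ) (α : ℂ) [NeZero n] (i : ℤ) : EnvHat n l α := ∑' b, lineTerm n l α i b

theorem hasSum_lineTerm (i : ℤ) : HasSum (lineTerm n l α i) (lineSum n l α i) :=
  (summable_of_null (tendsto_lineTerm i)).hasSum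

theorem lineSum_commute {i j : ℤ} (hij : ¬(n : ℤ) ∣ i - j) :
    lineSum n l α i * lineSum n l α j - lineSum n l α j * lineSum n l α i = 0 := by
  have hn := natCast_ne_zero' n
  have h := hasSum_commutator (hasSum_lineTerm (α := α) (n := n) (l := l) i) (hasSum_lineTerm j)
  simp only [lineTerm_commutator hij] at h
  set S := lineSum n l α i * lineSum n l α j - lineSum n l α j * lineSum n l α i
  -- The families are paired according to their support in the commutator: b ≡ j, c ≡ i and b ≡ c
  -- respectively. Each pair is reindexed below by k and c with r = i + nk.
  obtain ⟨S₁, h1⟩ := summable_cubic (tendsto_cubic₄ (n := n) (l := l) (α := α) i j)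
    (tendsto_cubic₃ i j)
  obtain ⟨S₂, h2⟩ := summable_cubic (tendsto_cubic₂ (n := n) (l := l) (α := α) i j)
    (tendsto_cubic₅ i j)
  obtain ⟨S₃, h3⟩ := summable_cubic (tendsto_cubic₆ (n := n) (l := l) (α := α) i j)
    (tendsto_cubic₁ i j)
  have hs : HasSum (fun q : ℤ × ℤ => cubicFamily n l α j (i + n * q.1) q.2) (S₁ + S₂ + S₃) := by
    refine ((h1.add h2).add h3).congr_fun fun q => ?_
    simp only [cubicFamily, Finset.sum_add_distrib]
  have hc := hasSum_cartanTerm_of_hasSum hij hs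
  have k1 := (hasSum_ite_range (T := fun q : ℤ × ℤ => (j - n * q.1, q.2)) (by
      rintro ⟨a, b⟩ ⟨a', b'⟩ h
      simpa [NeZero.ne n] using h)
    (fun q => (n : ℤ) ∣ q.1 - j) (by
      rintro ⟨b, c⟩
      constructor
      · rintro ⟨k, hk⟩
        exact ⟨(-k, c), Prod.ext (by dsimp only at hk ⊢; linarith) rfl⟩
      · rintro ⟨⟨k, c'⟩, h⟩
        obtain ⟨rfl, rfl⟩ := Prod.ext_iff.1 h
        exact ⟨-k, by dsimp only; ring⟩)
    (F := fun q => ∑ x : Fin l, ∑ y : Fin l, ∑ z : Fin l,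
        ((coef x y (q.1 - i) * coef x z (q.2 - j)) •
            (pE (n := n) α x i (q.2 + q.1 - j) * pE α z q.2 j * pE α y q.1 i)
          - (coef x y (q.1 - i) * coef z y (q.2 - j)) •
            (pE (n := n) α x i q.1 * pE α z j q.2 * pE α y q.2 (i + j - q.1)))) (by
      rintro ⟨k, c⟩
      refine Finset.sum_congr rfl fun x _ => Finset.sum_congr rfl fun y _ =>
        Finset.sum_congr rfl fun z _ => ?_
      rw [cubic₄, cubic₃]
      dsimp only
      rw [pE_shift x (p' := i + n * k) (q' := c) k rfl (q := c + (j - n * k) - j) (by ring),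
        pE_shift y (p' := j) (q' := i + n * k) k (p := j - n * k) (by ring) rfl,
        pE_shift x (p' := i + n * k) (q' := j) k rfl (q := j - n * k) (by ring),
        show j - n * k - i = j - (i + n * k) by ring,
        show i + j - (j - n * k) = i + n * k by ring])).2 h1
  have k2 := (hasSum_ite_range (T := fun q : ℤ × ℤ => (q.2 - n * q.1, i + n * q.1)) (by
      rintro ⟨a, b⟩ ⟨a', b'⟩ h
      simp only [Prod.mk.injEq, add_right_inj, mul_eq_mul_left_iff, hn, or_false] at h
      obtain ⟨h, rfl⟩ := h
      simpa using h)
    (fun q => (n : ℤ) ∣ q.2 - i) (by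
      rintro ⟨b, c⟩
      constructor
      · rintro ⟨k, hk⟩
        exact ⟨(k, b + n * k), Prod.ext (by dsimp only; ring) (by dsimp only at hk ⊢; linarith)⟩
      · rintro ⟨⟨k, c'⟩, h⟩
        obtain ⟨rfl, rfl⟩ := Prod.ext_iff.1 h
        exact ⟨k, by dsimp only; ring⟩)
    (F := fun q => ∑ x : Fin l, ∑ y : Fin l, ∑ z : Fin l,
        ((coef x y (q.1 - i) * coef z y (q.2 - j)) •
            (pE (n := n) α x i q.1 * pE α z j q.2 * pE α y q.1 (j + i - q.2))
          - (coef x y (q.1 - i) * coef x z (q.2 - j)) •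
            (pE (n := n) α x j (q.1 + q.2 - i) * pE α z q.2 j * pE α y q.1 i))) (by
      rintro ⟨k, c⟩
      refine Finset.sum_congr rfl fun x _ => Finset.sum_congr rfl fun y _ =>
        Finset.sum_congr rfl fun z _ => ?_
      rw [cubic₂, cubic₅]
      dsimp only
      rw [pE_shift x (p' := i + n * k) (q' := c) k rfl (q := c - n * k) (by ring),
        pE_shift y (p' := c) (q' := j) k (p := c - n * k) (q := j + i - (i + n * k)) (by ring)
          (by ring),
        pE_shift y (p' := c) (q' := i + n * k) k (p := c - n * k) (by ring) rfl,
        show c - n * k - i = c - (i + n * k) by ring,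
        show c - n * k + (i + n * k) - i = c by ring])).2 h2
  have k3 := (hasSum_ite_range (T := fun q : ℤ × ℤ => (q.2 - n * q.1, q.2)) (by
      rintro ⟨a, b⟩ ⟨a', b'⟩ h
      simp only [Prod.mk.injEq] at h
      obtain ⟨h, rfl⟩ := h
      simpa [NeZero.ne n] using h)
    (fun q => (n : ℤ) ∣ q.1 - q.2) (by
      rintro ⟨b, c⟩
      constructor
      · rintro ⟨k, hk⟩
        exact ⟨(-k, c), Prod.ext (by dsimp only at hk ⊢; linarith) rfl⟩
      · rintro ⟨⟨k, c'⟩, h⟩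
        obtain ⟨rfl, rfl⟩ := Prod.ext_iff.1 h
        exact ⟨-k, by dsimp only; ring⟩)
    (F := fun q => ∑ x : Fin l, ∑ y : Fin l, ∑ z : Fin l,
        ((coef x y (q.1 - i) * coef z x (q.2 - j)) •
            (pE (n := n) α z j q.2 * pE α x i (j + q.1 - q.2) * pE α y q.1 i)
          - (coef x y (q.1 - i) * coef y z (q.2 - j)) •
            (pE (n := n) α x i q.1 * pE α y j (i + q.2 - q.1) * pE α z q.2 j))) (by
      rintro ⟨k, c⟩
      refine Finset.sum_congr rfl fun x _ => Finset.sum_congr rfl fun y _ =>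
        Finset.sum_congr rfl fun z _ => ?_
      rw [cubic₆, cubic₁]
      dsimp only
      rw [pE_shift x (p' := i + n * k) (q' := c) k rfl (q := c - n * k) (by ring),
        pE_shift x (p' := i + n * k) (q' := j) k rfl (q := j + (c - n * k) - c) (by ring),
        pE_shift y (p' := c) (q' := i + n * k) k (p := c - n * k) (by ring) rfl,
        show c - n * k - i = c - (i + n * k) by ring,
        show i + c - (c - n * k) = i + n * k by ring])).2 h3
  have hr := h.sub ((k1.add k2).add k3)
  -- Once the cubic part is subtracted, each b admits only c = j + (b - i) and c = j - (b - i).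
  have hf : HasSum (fun b : ℤ => if (n : ℤ) ∣ b - i then
      central₁ (n := n) α l i j b (j + (b - i)) + central₂ α l i j b (j - (b - i)) else 0)
      (S - (S₁ + S₂ + S₃)) := by
    refine hr.prod_fiberwise fun b => ?_
    have e1 : HasSum (fun c : ℤ => if ((n : ℤ) ∣ b - i ∧ (n : ℤ) ∣ c - j) ∧ c - j = b - i then
        central₁ (n := n) α l i j b c else 0)
        (if (n : ℤ) ∣ b - i then central₁ (n := n) α l i j b (j + (b - i)) else 0) := by
      convert hasSum_single (f := fun c : ℤ =>
        if ((n : ℤ) ∣ b - i ∧ (n : ℤ) ∣ c - j) ∧ c - j = b - i then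
          central₁ (n := n) α l i j b c else 0) (j + (b - i))
        (fun c hc => if_neg fun h => hc (by linarith [h.2])) using 1
      simp
    have e2 : HasSum (fun c : ℤ => if ((n : ℤ) ∣ b - i ∧ (n : ℤ) ∣ c - j) ∧ c - j = -(b - i) then
        central₂ (n := n) α l i j b c else 0)
        (if (n : ℤ) ∣ b - i then central₂ (n := n) α l i j b (j - (b - i)) else 0) := by
      convert hasSum_single (f := fun c : ℤ =>
        if ((n : ℤ) ∣ b - i ∧ (n : ℤ) ∣ c - j) ∧ c - j = -(b - i) then
          central₂ (n := n) α l i j b c else 0) (j - (b - i))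
        (fun c hc => if_neg fun h => hc (by linarith [h.2])) using 1
      have : j - (b - i) - j = -(b - i) := by ring
      simp [this, dvd_sub_comm]
    rw [ite_add_zero]
    refine (e1.add e2).congr_fun fun c => ?_
    dsimp only
    abel
  rw [hasSum_ite_range (T := fun k : ℤ => i + n * k) (fun a b h => by simpa [NeZero.ne n] using h)
    (fun b => (n : ℤ) ∣ b - i) (fun b => ⟨fun ⟨k, hk⟩ => ⟨k, by dsimp only; linarith⟩,
      fun ⟨k, hk⟩ => ⟨k, by rw [← hk]; ring⟩⟩) (G := fun k => (k : ℂ) • cartanTerm n l α i j k)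
    (fun k => by rw [← central_add_central, add_sub_cancel_left])] at hf
  -- The central part sums ∑ k T_k to S - (S₁ + S₂ + S₃) and the cubic part sums ∑ (-k) T_k to S₁ +
  -- S₂ + S₃; adding them termwise gives S = 0.
  have h0 := hf.add hc
  simp only [neg_smul, add_neg_cancel, sub_add_cancel] at h0
  exact h0.unique hasSum_zero

end RectW
end

noncomputable section

namespace RectW

open Filter Topology UniformSpace

variable {n l : ℕ} {α : ℂ} [NeZero n]

/-! ### Cartan corrections -/

theorem pE_diag_comm (A x : Fin l) {i j : ℤ} (hij : ¬(n : ℤ) ∣ i - j) (b : ℤ) :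
    pE (n := n) α A i i * pE α x j b - pE α x j b * pE α A i i =
      if (n : ℤ) ∣ b - i then (-(if A = x then 1 else 0) : ℂ) • pE (n := n) α x j b else 0 := by
  rw [pE_comm, if_neg hij, if_neg (c := ((n : ℤ) ∣ i - b ∧ (n : ℤ) ∣ i - j) ∧ _) (by tauto),
    pdeg_self]
  have ec : (n : ℤ) ∣ i - b ↔ (n : ℤ) ∣ b - i := dvd_sub_comm
  simp only [ec, add_sub_cancel_left, Int.cast_zero, zero_smul, ite_self, add_zero, zero_sub]
  by_cases h : A = x
  · subst h
    split_ifs <;> simp_all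
  · simp [h]

theorem pE_diag_comm' (A y : Fin l) {i j : ℤ} (hij : ¬(n : ℤ) ∣ i - j) (b : ℤ) :
    pE (n := n) α A i i * pE α y b j - pE α y b j * pE α A i i =
      if (n : ℤ) ∣ b - i then (if A = y then 1 else 0 : ℂ) • pE (n := n) α y b j else 0 := by
  rw [pE_comm, if_neg hij, if_neg (c := ((n : ℤ) ∣ i - j ∧ (n : ℤ) ∣ i - b) ∧ _) (by tauto),
    pdeg_self]
  have ec : (n : ℤ) ∣ i - b ↔ (n : ℤ) ∣ b - i := dvd_sub_comm
  simp only [ec, Int.cast_zero, zero_smul, ite_self, add_zero, sub_zero]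
  by_cases h : A = y
  · subst h
    by_cases hb : (n : ℤ) ∣ b - i
    · simp only [if_pos hb, if_true, one_smul]
      exact pE_shift' A (dvd_sub_comm.1 hb) (by ring)
    · simp [hb]
  · simp [h]

theorem pE_diag_commute (A B : Fin l) {i j : ℤ} (hij : ¬(n : ℤ) ∣ i - j) :
    pE (n := n) α A i i * pE α B j j = pE α B j j * pE α A i i := by
  rw [← sub_eq_zero, pE_diag_comm A B hij, if_neg fun h => hij ((dvd_sub_comm).1 h)]

/-- The commutator of `E_{i,i}^{[A]}(0)` with a quadratic term. -/
theorem pE_diag_comm_lineTerm (A : Fin l) {i j : ℤ} (hij : ¬(n : ℤ) ∣ i - j) (b : ℤ) :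
    pE (n := n) α A i i * lineTerm n l α j b - lineTerm n l α j b * pE α A i i =
      if (n : ℤ) ∣ b - i then ∑ x : Fin l, ∑ y : Fin l,
        (coef x y (b - j) * ((if A = y then 1 else 0) - (if A = x then 1 else 0))) •
          (pE (n := n) α x j b * pE α y b j) else 0 := by
  have h : ∀ a x y : EnvHat n l α, a * (x * y) - x * y * a =
      (a * x - x * a) * y + x * (a * y - y * a) := fun a x y => by noncomm_ring
  simp only [lineTerm, Finset.mul_sum, Finset.sum_mul, ← Finset.sum_sub_distrib, mul_smul_comm,
    smul_mul_assoc, ← smul_sub, h, pE_diag_comm A _ hij, pE_diag_comm' A _ hij]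
  split_ifs
  · refine Finset.sum_congr rfl fun x _ => Finset.sum_congr rfl fun y _ => ?_
    rw [smul_mul_assoc, mul_smul_comm, ← add_smul, smul_smul]
    congr 1
    ring
  · simp

theorem hasSum_diag_comm_lineSum (A : Fin l) {i j : ℤ} (hij : ¬(n : ℤ) ∣ i - j) :
    HasSum (fun k : ℤ => ∑ x : Fin l, ∑ y : Fin l,
        (coef x y (i + n * k - j) * ((if A = y then 1 else 0) - (if A = x then 1 else 0))) •
          (pE (n := n) α x j (i + n * k) * pE α y (i + n * k) j))
      (pE (n := n) α A i i * lineSum n l α j - lineSum n l α j * pE α A i i) := by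
  have h := ((hasSum_lineTerm (α := α) (n := n) (l := l) j).mul_left (pE (n := n) α A i i)).sub
    ((hasSum_lineTerm (α := α) (n := n) (l := l) j).mul_right (pE (n := n) α A i i))
  simp only [pE_diag_comm_lineTerm A hij] at h
  exact (hasSum_ite_range (T := fun k : ℤ => i + n * k)
    (fun a b h => by simpa [NeZero.ne n] using h) (fun b => (n : ℤ) ∣ b - i)
    (fun b => ⟨fun ⟨k, hk⟩ => ⟨k, by dsimp only; linarith⟩,
      fun ⟨k, hk⟩ => ⟨k, by rw [← hk]; ring⟩⟩) (F := fun b => ∑ x : Fin l, ∑ y : Fin l,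
        (coef x y (b - j) * ((if A = y then 1 else 0) - (if A = x then 1 else 0))) •
          (pE (n := n) α x j b * pE α y b j)) (fun k => rfl)).1 h

/-- The terms match under k ↦ -k, translation by nk and exchange of the two copies. For x = y the
weight is zero; for x ≠ y the factors commute, and the coefficient and the weight both change sign.
-/
theorem diag_comm_lineSum_symm (A : Fin l) {i j : ℤ} (hij : ¬(n : ℤ) ∣ i - j) :
    pE (n := n) α A i i * lineSum n l α j - lineSum n l α j * pE α A i i =
      pE (n := n) α A j j * lineSum n l α i - lineSum n l α i * pE α A j j := by
  have h1 := hasSum_diag_comm_lineSum (α := α) A hij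
  have h2 := hasSum_diag_comm_lineSum (α := α) A (i := j) (j := i)
    (fun h => hij ((dvd_sub_comm).1 h))
  rw [← (Equiv.neg ℤ).hasSum_iff] at h2
  refine h1.unique (h2.congr_fun fun k => ?_)
  simp only [Function.comp, Equiv.neg_apply]
  rw [Finset.sum_comm]
  refine Finset.sum_congr rfl fun x _ => Finset.sum_congr rfl fun y _ => ?_
  by_cases hxy : x = y
  · subst hxy
    simp
  have hne : j + n * -k - i ≠ 0 := fun h => hij ⟨-k, by linarith⟩
  have hc := coef_add_coef_neg x y hne
  rw [if_neg hxy, neg_zero, show -(j + n * -k - i) = i + n * k - j by ring] at hc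
  rw [pE_commute (Ne.symm hxy), eq_neg_of_add_eq_zero_right hc,
    pE_shift x (p' := i + n * k) (q' := j) k rfl (q := j + n * -k) (by ring),
    pE_shift y (p' := j) (q' := i + n * k) k (p := j + n * -k) (by ring) rfl]
  congr 1
  ring

/-- The cross terms cancel by the symmetry in i and j; this needs the same β on both sides, but no
particular value of it. -/
theorem lineSum_add_cartan_commute (β : Fin l → ℂ) {i j : ℤ} (hij : ¬(n : ℤ) ∣ i - j) :
    ⁅lineSum n l α i + ∑ s, β s • pE (n := n) α s i i,
      lineSum n l α j + ∑ s, β s • pE (n := n) α s j j⁆ = 0 := by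
  have h1 := lineSum_commute (α := α) (n := n) (l := l) hij
  have h2 : (∑ s, β s • pE (n := n) α s i i) * lineSum n l α j
      - lineSum n l α j * (∑ s, β s • pE (n := n) α s i i) =
      (∑ s, β s • pE (n := n) α s j j) * lineSum n l α i
      - lineSum n l α i * (∑ s, β s • pE (n := n) α s j j) := by
    simp only [Finset.mul_sum, Finset.sum_mul, ← Finset.sum_sub_distrib, mul_smul_comm,
      smul_mul_assoc, ← smul_sub, diag_comm_lineSum_symm _ hij]
  have h3 : (∑ s, β s • pE (n := n) α s i i) * (∑ s, β s • pE (n := n) α s j j)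
      - (∑ s, β s • pE (n := n) α s j j) * (∑ s, β s • pE (n := n) α s i i) = 0 := by
    rw [sub_eq_zero, Finset.sum_mul_sum, Finset.sum_mul_sum, Finset.sum_comm]
    refine Finset.sum_congr rfl fun A _ => Finset.sum_congr rfl fun B _ => ?_
    rw [smul_mul_smul_comm, smul_mul_smul_comm, pE_diag_commute B A hij, mul_comm]
  rw [Ring.lie_def]
  simp only [add_mul, mul_add]
  linear_combination (norm := abel) h1 + h2 + h3

end RectW
end

noncomputable section

namespace RectW

open Filter Topology UniformSpace

/-! ### Linearity of derivation and Fourier coefficients -/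

section Linear

variable {n l : ℕ}

theorem deriv_eq (v : Words n l) :
    deriv v = Finsupp.linearCombination ℂ (fun w : FreeMonoid (Letter n l) =>
      derivWord w.toList) v.coeff := rfl

theorem deriv_zero : deriv (0 : Words n l) = 0 := by
  rw [deriv_eq, MonoidAlgebra.coeff_zero, map_zero]

theorem deriv_sum {ι : Type*} (s : Finset ι) (f : ι → Words n l) :
    deriv (∑ x ∈ s, f x) = ∑ x ∈ s, deriv (f x) := by
  simp only [deriv_eq, MonoidAlgebra.coeff_sum, map_sum]

theorem deriv_one : deriv (1 : Words n l) = 0 := by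
  rw [deriv_eq, MonoidAlgebra.one_def, MonoidAlgebra.coeff_single,
    Finsupp.linearCombination_single, FreeMonoid.toList_one, derivWord, smul_zero]

theorem deriv_letter (x : Letter n l) :
    deriv (MonoidAlgebra.single (FreeMonoid.of x) 1) =
      MonoidAlgebra.single (FreeMonoid.of { x with k := x.k + 1 }) ((x.k : ℂ) + 1) := by
  rw [deriv_eq, MonoidAlgebra.coeff_single, Finsupp.linearCombination_single, one_smul,
    FreeMonoid.toList_of, derivWord, derivWord, mul_zero, add_zero, FreeMonoid.ofList_singleton]

variable (α : ℂ)

theorem mode_eq (v : Words n l) (p : ℤ) :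
    mode α v p = Finsupp.linearCombination ℂ (fun w : FreeMonoid (Letter n l) =>
      wordMode α w.toList p) v.coeff := rfl

theorem mode_zero (p : ℤ) : mode α (0 : Words n l) p = 0 := by
  rw [mode_eq, MonoidAlgebra.coeff_zero, map_zero]

theorem mode_add (v w : Words n l) (p : ℤ) : mode α (v + w) p = mode α v p + mode α w p := by
  simp only [mode_eq, MonoidAlgebra.coeff_add, map_add]

theorem mode_smul (c : ℂ) (v : Words n l) (p : ℤ) : mode α (c • v) p = c • mode α v p := by
  simp only [mode_eq, MonoidAlgebra.coeff_smul, map_smul]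

theorem mode_sum {ι : Type*} (s : Finset ι) (f : ι → Words n l) (p : ℤ) :
    mode α (∑ x ∈ s, f x) p = ∑ x ∈ s, mode α (f x) p := by
  simp only [mode_eq, MonoidAlgebra.coeff_sum, map_sum]

theorem mode_single (w : FreeMonoid (Letter n l)) (c : ℂ) (p : ℤ) :
    mode α (MonoidAlgebra.single w c) p = c • wordMode α w.toList p := by
  rw [mode_eq, MonoidAlgebra.coeff_single, Finsupp.linearCombination_single]

theorem wordMode_singleton (x : Letter n l) (p : ℤ) : wordMode α [x] p = letterMode α x p := by
  have e : ∀ q : ℕ, normalOrderTerm (letterMode α x) (wordMode α []) p q =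
      (if (p + q = -1) then letterMode α x (-1 - q) else 0) +
        (if p - 1 - q = -1 then letterMode α x q else 0) := by
    intro q
    simp only [normalOrderTerm, wordMode]
    split_ifs <;> simp
  rw [wordMode, tsum_congr e]
  -- The vacuum has only the mode -1, so a single term survives: q = p in the second half for p ≥ 0,
  -- and q = -1 - p in the first half for p < 0.
  rcases le_or_gt 0 p with h | h
  · lift p to ℕ using h
    rw [tsum_eq_single p]
    · rw [if_neg (by omega), if_pos (by omega), zero_add]
    · intro q hq
      rw [if_neg (by omega), if_neg (by omega), zero_add]
  · obtain ⟨q, rfl⟩ : ∃ q : ℕ, p = -1 - q := ⟨(-1 - p).toNat, by omega⟩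
    rw [tsum_eq_single q]
    · rw [if_pos (by omega), if_neg (by omega), add_zero]
    · intro r hr
      rw [if_neg (by omega), if_neg (by omega), zero_add]

theorem letterMode_zero (s : Fin l) (i j : Fin n) (p : ℤ) :
    letterMode α ⟨s, i, j, 0⟩ p = E α s i j p := by
  simp [letterMode]

theorem letterMode_one (s : Fin l) (i j : Fin n) (p : ℤ) :
    letterMode α ⟨s, i, j, 1⟩ p = (-p : ℤ) • E α s i j (p - 1) := by
  simp [letterMode]

theorem mode_matA (s : Fin l) (i j : Fin n) (p : ℤ) :
    mode α (matA s i j) p = E α s i j p := by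
  rw [matA, Matrix.of_apply, mode_single, one_smul, FreeMonoid.toList_of, wordMode_singleton,
    letterMode_zero]

theorem mode_deriv_matA (s : Fin l) (i j : Fin n) (p : ℤ) :
    mode α (deriv (matA s i j)) p = (-p : ℤ) • E α s i j (p - 1) := by
  rw [matA, Matrix.of_apply, deriv_letter, mode_single, FreeMonoid.toList_of, wordMode_singleton]
  simp only [Nat.cast_zero, zero_add, one_smul, letterMode_one]

theorem mode_matA_mul_matA (s t : Fin l) (i a j : Fin n) (p : ℤ) :
    mode α (matA s i a * matA t a j) p =
      ∑' q : ℕ, (E α s i a (-1 - q) * E α t a j (p + q) + E α t a j (p - 1 - q) * E α s i a q) := by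
  rw [matA, matA, Matrix.of_apply, Matrix.of_apply, MonoidAlgebra.single_mul_single, mode_single,
    mul_one, one_smul, FreeMonoid.toList_mul, FreeMonoid.toList_of, FreeMonoid.toList_of]
  rw [List.singleton_append, wordMode]
  refine tsum_congr fun q => ?_
  simp only [normalOrderTerm, wordMode_singleton, letterMode_zero]

end Linear

/-! ### The first two coefficients of the Miura transformation -/

section Miura

variable {n l : ℕ} (α : ℂ)

/-- The coefficients of the partial products `∏ (τ + A^{[s]})`. -/
def partialMiura (L : List (Fin l)) : ℕ → Matrix (Fin n) (Fin n) (Words n l) :=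
  L.foldl (mulTauAdd α) (fun k => if k = 0 then 1 else 0)

theorem partialMiura_append (L : List (Fin l)) (s : Fin l) :
    partialMiura (n := n) α (L ++ [s]) = mulTauAdd α (partialMiura α L) s := by
  rw [partialMiura, List.foldl_append]
  rfl

theorem map_deriv_one : (1 : Matrix (Fin n) (Fin n) (Words n l)).map deriv = 0 := by
  refine Matrix.ext fun i j => ?_
  rw [Matrix.map_apply, Matrix.one_apply]
  split_ifs
  · exact deriv_one
  · exact deriv_zero

theorem map_deriv_zero : (0 : Matrix (Fin n) (Fin n) (Words n l)).map deriv = 0 :=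
  Matrix.ext fun _ _ => deriv_zero

theorem map_deriv_sum (S : Finset (Fin l)) :
    (∑ s ∈ S, matA (n := n) s).map deriv = ∑ s ∈ S, (matA s).map deriv := by
  ext i j : 2
  simp only [Matrix.map_apply, Matrix.sum_apply, deriv_sum]

theorem partialMiura_eq_zero (L : List (Fin l)) {k : ℕ} (hk : L.length < k) :
    partialMiura (n := n) α L k = 0 := by
  induction L using List.reverseRecOn generalizing k with
  | nil => exact if_neg (by simpa using hk.ne')
  | append_singleton L s ih =>
    rw [List.length_append, List.length_singleton] at hk
    rw [partialMiura_append, mulTauAdd, if_neg (by omega), ih (by omega), ih (by omega),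
      map_deriv_zero, smul_zero, zero_mul, add_zero, add_zero]

theorem partialMiura_length (L : List (Fin l)) :
    partialMiura (n := n) α L L.length = 1 := by
  induction L using List.reverseRecOn with
  | nil => rfl
  | append_singleton L s ih =>
    rw [List.length_append, List.length_singleton, partialMiura_append, mulTauAdd,
      if_neg (by omega), Nat.add_sub_cancel, ih, partialMiura_eq_zero α L (by omega),
      map_deriv_zero, smul_zero, zero_mul, add_zero, add_zero]

theorem partialMiura_linear (L : List (Fin l)) (hL : L.Nodup) :
    (if L.length < 1 then 0 else partialMiura (n := n) α L (L.length - 1)) =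
      ∑ s ∈ L.toFinset, matA s := by
  induction L using List.reverseRecOn with
  | nil => simp
  | append_singleton L s ih =>
    rw [List.nodup_append] at hL
    have hs : s ∉ L.toFinset := fun h => hL.2.2 s (List.mem_toFinset.1 h) s (by simp) rfl
    rw [List.length_append, List.length_singleton, if_neg (by omega), Nat.add_sub_cancel,
      partialMiura_append, mulTauAdd, partialMiura_length, map_deriv_one, smul_zero, zero_add,
      one_mul]
    have : (if L.length = 0 then 0 else partialMiura (n := n) α L (L.length - 1)) =
        ∑ s ∈ L.toFinset, matA s := by
      rw [← ih hL.1]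
      simp only [Nat.lt_one_iff]
    rw [this, List.toFinset_append, List.toFinset_cons, List.toFinset_nil,
      Finset.union_comm, Finset.insert_union, Finset.empty_union, Finset.sum_insert hs, add_comm]

/-- The derivative coefficients may stay unspecified: they only yield Cartan terms, for which any β
common to all matrix entries will do. The guard on the length replaces a negative power of τ by
zero. -/
theorem partialMiura_quadratic (L : List (Fin l)) (hL : L.Pairwise (· < ·)) :
    ∃ β : Fin l → ℂ,
    (if L.length < 2 then 0 else partialMiura (n := n) α L (L.length - 2)) =
      ∑ t ∈ L.toFinset, ∑ s ∈ L.toFinset with s < t, matA s * matA t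
        + ∑ s, β s • (matA s).map deriv := by
  induction L using List.reverseRecOn with
  | nil => exact ⟨0, by simp⟩
  | append_singleton L u ih =>
    rw [List.pairwise_append] at hL
    have hu : ∀ s ∈ L.toFinset, s < u := fun s hs =>
      hL.2.2 s (List.mem_toFinset.1 hs) u (by simp)
    have hu' : u ∉ L.toFinset := fun h => (hu u h).false
    obtain ⟨β, hβ⟩ := ih hL.1
    have h1 := partialMiura_linear (n := n) α L hL.1.nodup
    have hS : (L ++ [u]).toFinset = insert u L.toFinset := by
      rw [List.toFinset_append, List.toFinset_cons, List.toFinset_nil,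
        Finset.union_comm, Finset.insert_union, Finset.empty_union]
    have hQ : ∑ t ∈ (L ++ [u]).toFinset, ∑ s ∈ (L ++ [u]).toFinset with s < t,
        matA (n := n) s * matA t =
        (∑ s ∈ L.toFinset, matA s) * matA u +
          ∑ t ∈ L.toFinset, ∑ s ∈ L.toFinset with s < t, matA s * matA t := by
      rw [hS, Finset.sum_insert hu', Finset.filter_insert, if_neg (lt_irrefl u),
        Finset.filter_true_of_mem hu, Finset.sum_mul]
      congr 1
      refine Finset.sum_congr rfl fun t ht => ?_
      rw [Finset.filter_insert, if_neg (hu t ht).not_gt]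
    rw [hQ, List.length_append, List.length_singleton]
    by_cases h0 : L.length = 0
    · refine ⟨0, ?_⟩
      rw [List.length_eq_zero_iff] at h0
      subst h0
      simp
    -- Moving the new τ to the left past the linear coefficient ∑ A^{[s]} adds α ∂A^{[s]} for each
    -- earlier s.
    refine ⟨fun s => β s + if s ∈ L.toFinset then α else 0, ?_⟩
    rw [if_neg (by omega)] at h1 ⊢
    rw [show L.length + 1 - 2 = L.length - 1 by omega, partialMiura_append, mulTauAdd, h1]
    have h2 : (if L.length - 1 = 0 then 0 else partialMiura (n := n) α L (L.length - 1 - 1)) =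
        if L.length < 2 then 0 else partialMiura (n := n) α L (L.length - 2) :=
      if_congr (by omega) rfl rfl
    rw [h2, hβ, map_deriv_sum]
    simp only [add_smul, Finset.sum_add_distrib, ite_smul, zero_smul, Finset.sum_ite_mem,
      Finset.univ_inter, Finset.smul_sum]
    abel

theorem W_one (hl : 1 ≤ l) (i j : Fin n) :
    W (l := l) α 1 i j = ∑ s, matA s i j := by
  have h := partialMiura_linear (n := n) α (List.finRange l) (List.nodup_finRange l)
  rw [List.length_finRange, if_neg (by omega)] at h
  rw [W, if_pos hl, miuraCoeff]
  refine (congrFun (congrFun h i) j).trans ?_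
  rw [Matrix.sum_apply, List.toFinset_finRange]

theorem W_two : ∃ β : Fin l → ℂ, ∀ i j : Fin n,
    W (l := l) α 2 i j = ∑ t, ∑ s with s < t, ∑ a, matA s i a * matA t a j
      + ∑ s, β s • deriv (matA s i j) := by
  obtain ⟨β, hβ⟩ := partialMiura_quadratic (n := n) α (List.finRange l)
    (List.pairwise_lt_finRange l)
  refine ⟨β, fun i j => ?_⟩
  have h := congrFun (congrFun hβ i) j
  simp only [List.length_finRange, List.toFinset_finRange, Matrix.add_apply, Matrix.sum_apply,
    Matrix.smul_apply, Matrix.map_apply, Matrix.mul_apply] at h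
  rw [← h, W]
  by_cases h2 : l < 2
  · rw [if_pos h2, if_neg (by omega)]
    rfl
  · rw [if_neg h2, if_pos (by omega)]
    rfl

theorem Wm_one (hl : 1 ≤ l) (i j : Fin n) (m : ℤ) :
    Wm n l α 1 i j m = ∑ s, E α s i j m := by
  rw [Wm, W_one α hl, mode_sum]
  refine Finset.sum_congr rfl fun s _ => ?_
  rw [mode_matA]
  congr 1
  push_cast
  ring

theorem Wm_two_zero : ∃ β : Fin l → ℂ, ∀ i j : Fin n,
    Wm n l α 2 i j 0 = ∑ t, ∑ s with s < t, ∑ a, mode α (matA s i a * matA t a j) 1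
      + ∑ s, β s • E α s i j 0 := by
  obtain ⟨β, hβ⟩ := W_two (n := n) (l := l) α
  -- The relevant mode is p = 0 + 2 - 1 = 1, and (∂X)_{(1)} = -X(0), hence the sign.
  refine ⟨fun s => -β s, fun i j => ?_⟩
  rw [Wm, hβ, show (0 : ℤ) + ((2 : ℕ) : ℤ) - 1 = 1 by norm_num]
  simp only [mode_add, mode_sum, mode_smul, mode_deriv_matA, sub_self]
  congr 1
  refine Finset.sum_congr rfl fun s _ => ?_
  simp

end Miura

end RectW
end

noncomputable section

namespace RectW

open Filter Topology UniformSpace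

variable {n l : ℕ} {α : ℂ}

/-! ### Degree-wise closed subalgebras -/

theorem topDegreePart_le_topGenerated {ι : Type*} (g : ι → EnvHat n l α) (deg : ι → ℤ) (d : ℤ)
    {x : EnvHat n l α} (hx : x ∈ topDegreePart g deg d) : x ∈ topGenerated g deg :=
  Submodule.mem_iSup_of_mem (p := fun d => topDegreePart g deg d) d hx

theorem gen_mem_topDegreePart {ι : Type*} (g : ι → EnvHat n l α) (deg : ι → ℤ) (x : ι) :
    g x ∈ topDegreePart g deg (deg x) :=
  Submodule.le_topologicalClosure _ (Submodule.subset_span ⟨[x], by simp, by simp⟩)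

theorem tsum_mem_topDegreePart {ι κ : Type*} {g : ι → EnvHat n l α} {deg : ι → ℤ} {d : ℤ}
    {f : κ → EnvHat n l α} (h : ∀ k, f k ∈ topDegreePart g deg d) :
    ∑' k, f k ∈ topDegreePart g deg d :=
  tsum_mem (Submodule.isClosed_topologicalClosure _) h

theorem W_eq_zero {r : ℕ} (hr : l < r) (i j : Fin n) : W (l := l) α r i j = 0 :=
  if_neg hr.not_ge

/-- For r > l the element is zero rather than a generator; this covers W^{(2)} when l = 1. -/
theorem Wm_mem_currentPart {r : ℕ} (hr : 1 ≤ r) (i j : Fin n) (m : ℤ) :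
    Wm n l α r i j m ∈ topDegreePart (fun x : Fin l × Fin n × Fin n × ℤ =>
      Wm n l α (x.1 + 1) x.2.1 x.2.2.1 x.2.2.2) (fun x => x.2.2.2) m := by
  by_cases h : r ≤ l
  · have := gen_mem_topDegreePart (fun x : Fin l × Fin n × Fin n × ℤ =>
      Wm n l α (x.1 + 1) x.2.1 x.2.2.1 x.2.2.2) (fun x => x.2.2.2) (⟨r - 1, by omega⟩, i, j, m)
    simpa only [Nat.sub_add_cancel hr] using this
  · rw [Wm, W_eq_zero (not_le.1 h), mode_zero]
    exact zero_mem _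

theorem D_mem_currentAlgebra (i : Fin n) : D n l α i ∈ currentAlgebra n l α := by
  refine topDegreePart_le_topGenerated _ _ 0 (sub_mem (Wm_mem_currentPart one_le_two i i 0)
    (tsum_mem_topDegreePart fun m => add_mem (sum_mem fun a _ => ?_) (sum_mem fun a _ => ?_)))
  · have := mul_mem_topDegreePart (Wm_mem_currentPart (l := l) (α := α) le_rfl i a (-m))
      (Wm_mem_currentPart (l := l) (α := α) le_rfl a i m)
    rwa [neg_add_cancel] at this
  · have := mul_mem_topDegreePart (Wm_mem_currentPart (l := l) (α := α) le_rfl i a (-m - 1))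
      (Wm_mem_currentPart (l := l) (α := α) le_rfl a i (m + 1))
    rwa [show (-m - 1 + (m + 1) : ℤ) = 0 by ring] at this

/-! ### The elements `D_i` as quadratic series -/

theorem fin_div (a : Fin n) : (a : ℤ) / n = 0 :=
  Int.ediv_eq_zero_of_lt (by positivity) (by exact_mod_cast a.2)

variable [NeZero n]

theorem residue_fin_add (a : Fin n) (x : ℤ) : residue n ((a : ℤ) + n * x) = a := by
  rw [residue_congr x rfl, residue_fin]

theorem fin_add_div (a : Fin n) (x : ℤ) : ((a : ℤ) + n * x) / n = x := by
  rw [div_shift x rfl, fin_div, zero_add]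

theorem pE_fin_left (s : Fin l) (i a : Fin n) (x : ℤ) :
    pE α s (i : ℤ) ((a : ℤ) + n * x) = E α s i a x := by
  rw [pE, residue_fin, residue_fin_add, pdeg, fin_add_div, fin_div, sub_zero]

theorem pE_fin_right (s : Fin l) (i a : Fin n) (x : ℤ) :
    pE α s ((a : ℤ) + n * x) (i : ℤ) = E α s a i (-x) := by
  rw [pE, residue_fin, residue_fin_add, pdeg, fin_add_div, fin_div, zero_sub]

theorem pE_fin_diag (s : Fin l) (i : Fin n) : pE α s (i : ℤ) (i : ℤ) = E α s i i 0 := by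
  rw [pE, residue_fin, pdeg_self]

theorem tendsto_pE_mul_pE {s t : Fin l} (hst : s ≠ t) (i : ℤ) :
    Tendsto (fun b => pE (n := n) α s i b * pE α t b i) cofinite (𝓝 0) := by
  rw [tendsto_cofinite_iff]
  intro m
  refine (Set.finite_Icc (i - n * (m + 2)) (i + n * (m + 2))).subset fun b hb => ?_
  by_contra hc
  rw [Set.mem_Icc, not_and_or, not_le, not_le] at hc
  apply hb
  rcases hc with h | h
  · exact mul_mem_nhd m _ (pE_mem_nhd _ (by omega))
  · rw [pE_commute hst]
    exact mul_mem_nhd m _ (pE_mem_nhd _ (by omega))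

/-- Distinct copies commute, so normal ordering has no effect: its two halves are the parts x = q
and x = -(q + 1) of one series over x ∈ ℤ. Division with remainder, b = a + nx, merges these series
over a. -/
theorem hasSum_mode_matA_mul_matA {s t : Fin l} (hst : s ≠ t) (i : Fin n) :
    HasSum (fun b : ℤ => pE (n := n) α s i b * pE α t b i)
      (∑ a, mode α (matA s i a * matA t a i) 1) := by
  have hs := summable_of_null (tendsto_pE_mul_pE (n := n) (α := α) hst i)
  have ha : ∀ a : Fin n, HasSum (fun x : ℤ => E α s i a x * E α t a i (-x))
      (mode α (matA s i a * matA t a i) 1) := by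
    intro a
    have h : Summable fun x : ℤ => E α s i a x * E α t a i (-x) := by
      have hinj : Function.Injective fun x : ℤ => (a : ℤ) + n * x := fun x y h => by
        simpa [NeZero.ne n] using h
      refine summable_of_null (((tendsto_pE_mul_pE (n := n) (α := α) hst i).comp
        hinj.tendsto_cofinite).congr fun x => ?_)
      simp only [Function.comp, pE_fin_left, pE_fin_right]
    convert h.hasSum using 1
    rw [mode_matA_mul_matA, ← h.hasSum.nat_add_neg_add_one.tsum_eq]
    refine tsum_congr fun q => ?_
    have hc : E α t a i (-q) * E α s i a q = E α s i a q * E α t a i (-q) := by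
      rw [← sub_eq_zero, E_comm, if_neg hst.symm]
    rw [sub_self, zero_sub, hc, add_comm]
    congr 3 <;> ring
  have h2 := (Int.divModEquiv n).symm.hasSum_iff.2 hs.hasSum
  have h3 := ((Equiv.prodComm (Fin n) ℤ).hasSum_iff.2 h2).prod_fiberwise (g := fun a =>
    mode α (matA s i a * matA t a i) 1) fun a => by
      refine (ha a).congr_fun fun x => ?_
      rw [← pE_fin_left, ← pE_fin_right, ← add_comm, mul_comm]
      rfl
  rw [← h3.unique (hasSum_fintype _)]
  exact hs.hasSum

/-- The index of the `(m, a)`-th term of the series subtracted in `D_i`. -/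
def belowIndex (i : Fin n) (x : ℕ × Fin n) : ℤ :=
  x.2 + n * (if x.2 < i then -(x.1 : ℤ) else -(x.1 : ℤ) - 1)

theorem belowIndex_injective (i : Fin n) : Function.Injective (belowIndex i) := by
  rintro ⟨m, a⟩ ⟨m', a'⟩ h
  have h1 := congrArg (residue n) h
  simp only [belowIndex, residue_fin_add] at h1
  subst h1
  have h2 := congrArg (· / (n : ℤ)) h
  simp only [belowIndex, fin_add_div] at h2
  refine Prod.ext ?_ rfl
  dsimp only
  split_ifs at h2 <;> omega

/-- Writing b = a + nx, the inequality b < i means x ≤ 0 if a < i and x ≤ -1 if a ≥ i. This explains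
the two different ranges in the series defining D_i. -/
theorem mem_range_belowIndex (i : Fin n) (b : ℤ) : b < i ↔ b ∈ Set.range (belowIndex i) := by
  have hn := natCast_pos' n
  constructor
  · intro hb
    have h1 := Int.mul_ediv_add_emod b n
    have h2 := residue_val (n := n) b
    have h3 := Int.emod_nonneg b hn.ne'
    have h4 : (i : ℤ) < n := by exact_mod_cast i.2
    by_cases h : residue n b < i
    · have h5 : b / n ≤ 0 := by
        have : b / n < 1 := Int.ediv_lt_of_lt_mul hn (by linarith)
        omega
      refine ⟨((-(b / n)).toNat, residue n b), ?_⟩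
      rw [belowIndex, if_pos h, h2, Int.toNat_of_nonneg (by omega)]
      linarith
    · have h6 : (i : ℤ) ≤ (residue n b : ℕ) := by exact_mod_cast not_lt.1 h
      have h5 : b / n < 0 := by
        by_contra hc
        have := mul_nonneg hn.le (not_lt.1 hc)
        linarith
      refine ⟨((-(b / n) - 1).toNat, residue n b), ?_⟩
      rw [belowIndex, if_neg h, h2, Int.toNat_of_nonneg (by omega)]
      linarith
  · rintro ⟨⟨m, a⟩, rfl⟩
    rw [belowIndex]
    have h2 : (a : ℤ) < n := by exact_mod_cast a.2
    have h3 : (0 : ℤ) ≤ n * m := by positivity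
    dsimp only
    split_ifs with h
    · have h1 : (a : ℤ) < i := by exact_mod_cast h
      linarith
    · have h1 : (0 : ℤ) ≤ i := by positivity
      linarith

theorem hasSum_quadTerm (hl : 1 ≤ l) (i : Fin n) : ∃ S,
    HasSum (fun b : ℤ => if b < i then ∑ x : Fin l, ∑ y : Fin l,
      pE (n := n) α x i b * pE α y b i else 0) S ∧ HasSum (quadTerm n l α i) S := by
  have hs : Summable fun b : ℤ => if b < i then ∑ x : Fin l, ∑ y : Fin l,
      pE (n := n) α x i b * pE α y b i else 0 := by
    refine summable_of_null (tendsto_cofinite_iff.2 fun m => ?_)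
    refine (Set.finite_Icc ((i : ℤ) - n * (m + 2)) (i : ℤ)).subset fun b hb => ?_
    by_contra hc
    rw [Set.mem_Icc, not_and_or, not_le, not_le] at hc
    refine hb ?_
    split_ifs with h
    · exact sum_mem_nhd m _ fun x _ => sum_mem_nhd m _ fun y _ =>
        mul_mem_nhd m _ (pE_mem_nhd _ (by omega))
    · exact zero_mem_nhd m
  refine ⟨_, hs.hasSum, ?_⟩
  have h := (hasSum_ite_range (belowIndex_injective i) _ (mem_range_belowIndex i)
    fun x => rfl).1 hs.hasSum
  refine h.prod_fiberwise fun m => ?_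
  convert hasSum_fintype _ using 1
  rw [quadTerm, ← Finset.sum_filter_add_sum_filter_not Finset.univ (fun a => a < i)]
  simp only [not_lt]
  congr 1
  · refine Finset.sum_congr rfl fun a ha => ?_
    rw [Finset.mem_filter] at ha
    simp only [belowIndex, if_pos ha.2, pE_fin_left, pE_fin_right, neg_neg, Wm_one α hl,
      Finset.sum_mul_sum]
  · refine Finset.sum_congr rfl fun a ha => ?_
    rw [Finset.mem_filter] at ha
    simp only [belowIndex, if_neg ha.2.not_gt, pE_fin_left, pE_fin_right, Wm_one α hl,
      Finset.sum_mul_sum, neg_sub, sub_neg_eq_add, add_comm (1 : ℤ)]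

theorem summable_quadTerm (hl : 1 ≤ l) (i : Fin n) : Summable (quadTerm n l α i) := by
  obtain ⟨S, -, h⟩ := hasSum_quadTerm (α := α) hl i
  exact h.summable

/-- W^{(2)} supplies the part [x < y] of the coefficient and the subtracted series the part -[b <
i]. -/
theorem exists_D_eq (hl : 1 ≤ l) : ∃ β : Fin l → ℂ, ∀ i : Fin n,
    D n l α i = lineSum n l α (i : ℤ) + ∑ s, β s • pE (n := n) α s i i := by
  obtain ⟨β, hβ⟩ := Wm_two_zero (n := n) (l := l) α
  refine ⟨β, fun i => ?_⟩
  obtain ⟨S, h1, h2⟩ := hasSum_quadTerm (α := α) hl i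
  have h3 : HasSum (fun b : ℤ => ∑ t, ∑ s : Fin l with s < t, pE (n := n) α s i b * pE α t b i)
      (∑ t, ∑ s : Fin l with s < t, ∑ a, mode α (matA s i a * matA t a i) 1) :=
    hasSum_sum fun t _ => hasSum_sum fun s hs =>
      hasSum_mode_matA_mul_matA (Finset.mem_filter.1 hs).2.ne i
  have h4 := (h3.sub h1).unique ((hasSum_lineTerm (α := α) (n := n) (l := l) i).congr_fun
    fun b => by
      simp only [lineTerm]
      rw [Finset.sum_comm]
      simp only [coef, sub_smul, Finset.sum_sub_distrib, ite_smul, one_smul, zero_smul, sub_neg,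
        Finset.sum_filter]
      congr 1
      · rw [Finset.sum_comm]
      · split_ifs
        · rw [Finset.sum_comm]
        · simp)
  rw [D, hβ, h2.tsum_eq, ← h4]
  simp only [pE_fin_diag]
  abel

/-! ### Membership -/

theorem lineSum_mem_homogHat (i : ℤ) : lineSum n l α i ∈ homogHat n l α 0 := by
  refine tsum_mem_topDegreePart fun b => sum_mem fun x _ => sum_mem fun y _ =>
    Submodule.smul_mem _ _ ?_
  have := mul_mem_topDegreePart (pE_mem_homogHat (n := n) (α := α) x i b)
    (pE_mem_homogHat (n := n) (α := α) y b i)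
  rwa [show pdeg n i b + pdeg n b i = 0 by simp [pdeg]] at this

theorem D_mem_envComp (hl : 1 ≤ l) (i : Fin n) : D n l α i ∈ envComp n l α := by
  obtain ⟨β, hβ⟩ := exists_D_eq (n := n) (α := α) hl
  refine topDegreePart_le_topGenerated _ _ 0 ?_
  rw [hβ]
  refine add_mem (lineSum_mem_homogHat _) (sum_mem fun s _ => Submodule.smul_mem _ _ ?_)
  have := pE_mem_homogHat (n := n) (α := α) s i i
  rwa [pdeg_self] at this

theorem D_commute (hl : 1 ≤ l) (i j : Fin n) : ⁅D n l α i, D n l α j⁆ = 0 := by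
  obtain ⟨β, hβ⟩ := exists_D_eq (n := n) (α := α) hl
  by_cases hij : i = j
  · rw [hij, Ring.lie_def, sub_self]
  rw [hβ, hβ]
  -- Distinct elements of `Fin n` are incongruent modulo n.
  refine lineSum_add_cartan_commute β fun h => hij ?_
  rw [← residue_fin i, ← residue_fin j]
  exact (residue_eq_iff _ _).2 h

end RectW
end
theorem proposition11p1 (n l : ℕ) (hn : 1 ≤ n) (hl : 1 ≤ l) (k α : ℂ)
    (hα : α = k + ((l : ℂ) - 1) * n) :
    (∀ i : Fin n, Summable (RectW.quadTerm n l α i)) ∧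
    (∀ i : Fin n, RectW.D n l α i ∈ RectW.envComp n l α ∧
      RectW.D n l α i ∈ RectW.currentAlgebra n l α) ∧
    ∀ i j : Fin n, ⁅RectW.D n l α i, RectW.D n l α j⁆ = 0 := by
  have : NeZero n := ⟨by omega⟩
  exact ⟨RectW.summable_quadTerm hl,
    fun i => ⟨RectW.D_mem_envComp hl i, RectW.D_mem_currentAlgebra i⟩, RectW.D_commute hl⟩
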